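/- Let $k,n,s$ be integers with $1\le s\le k\le n-k$, let $G(k,n)$ be the Grassmannian of $k$-dimensional linear subspaces of $\mathbb R^n$ (with its usual topology), and fix $\mathbf W\in G(k,n)$. For $\mathbf E,\mathbf F\in G(k,n)$, principal vectors $(p_1,q_1),\dots,(p_k,q_k)$ between $\mathbf E$ and $\mathbf F$ are chosen recursively: $(p_i,q_i)$ maximizes $\langle p,q\rangle$ over all unit vectors $p\in\mathbf E$, $p\perp p_1,\dots,p_{i-1}$ and $q\in\mathbf F$, $q\perp q_1,\dots,q_{i-1}$. The principal angles between $\mathbf E$ and $\mathbf F$ are $\theta_i(\mathbf E,\mathbf F)=\arccos\langle p_i,q_i\rangle\in[0,\pi/2]$, $i=1,\dots,k$; they are nondecreasing in $i$ and do not depend on the choice of principal vectors. The Grassmann distance is $$\delta(\mathbf E,\mathbf F)=\Big(\sum_{i=1}^k\theta_i(\mathbf E,\mathbf F)^2\Big)^{1/2}.$$ Write $\delta_{\mathbf L}(\mathbf E)=\delta(\mathbf L,\mathbf E)$ and $\theta_i(\mathbf L)=\theta_i(\mathbf L,\mathbf W)$, and let $$\Omega_s=\{\mathbf E\in G(k,n)\;:\;\dim(\mathbf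 E\cap\mathbf W)\ge s\}.$$ (1) The set of all $\mathbf L\in G(k,n)$ with $0<\theta_1(\mathbf L)<\dots<\theta_k(\mathbf L)<\frac{\pi}{2}$ is generic: it contains a dense subset of $G(k,n)$ of the form $\{\mathbf L : P(\mathbf L)\neq 0\}$, where $P$ is a real polynomial in the entries of the matrix of the orthogonal projection onto $\mathbf L$. (2) Every $\mathbf L$ with $0<\theta_1(\mathbf L)<\dots<\theta_k(\mathbf L)<\frac{\pi}{2}$ satisfies $\mathbf L\notin\Omega_s$, the function $\delta_{\mathbf L}$ attains a maximum on $\Omega_s$, and $$\max\delta_{\mathbf L}|_{\Omega_s}=\Big(\theta_{k-s+1}(\mathbf L)^2+\dots+\theta_k(\mathbf L)^2+(k-s)\big(\tfrac{\pi}{2}\big)^2\Big)^{1/2}.$$ Moreover, let $(p_1,q_1),\dots,(p_k,q_k)$ be any principal vectors between $\mathbf L$ and $\mathbf W$, and put $\mathbf E_{\mathbf W}=\mathrm{span}\{q_{k-s+1},\dots,q_k\}$ and $\mathbf A=\mathbf L^\perp\cap\mathbf E_{\mathbf W}^\perp$. Then $\dim\mathbf E_{\mathbf W}=s$, $\dim\mathbf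 A=n-k-s$, and the global maximizers of $\delta_{\mathbf L}|_{\Omega_s}$ are exactly the planes $\mathbf B\oplus\mathbf E_{\mathbf W}$, where $\mathbf B$ is a $(k-s)$-dimensional subspace of $\mathbf A$. The set of global maximizers is a copy of the Grassmannian $G(k-s,n-k-s)$: for every linear isometric embedding $\varphi:\mathbb R^{n-k-s}\to\mathbb R^n$ with image $\mathbf A$, the map $$G(k-s,n-k-s)\to G(k,n),\qquad \mathbf B\mapsto\varphi(\mathbf B)\oplus\mathbf E_{\mathbf W}$$ is a topological embedding whose image is the set of global maximizers of $\delta_{\mathbf L}|_{\Omega_s}$. -/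

import Mathlib

open scoped RealInnerProductSpace

/-- Euclidean space `ℝⁿ` with its standard scalar product. -/
abbrev Euc (n : ℕ) : Type := EuclideanSpace ℝ (Fin n)

/-- The real Grassmannian `G(k,n)` of `k`-dimensional linear subspaces of `ℝⁿ`. -/
def Grass (k n : ℕ) : Type := {E : Submodule ℝ (Euc n) // Module.finrank ℝ E = k}

namespace Grass

/-- The linear subspace underlying a point of the Grassmannian. -/
def space {k n : ℕ} (E : Grass k n) : Submodule ℝ (Euc n) := E.1

theorem finrank_space {k n : ℕ} (E : Grass k n) : Module.finrank ℝ E.space = k := E.2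

/-- The usual topology of `G(k,n)`: a plane is identified with the orthogonal projection onto it. -/
noncomputable instance (k n : ℕ) : TopologicalSpace (Grass k n) :=
  TopologicalSpace.induced (fun E : Grass k n => E.space.starProjection) inferInstance

/-- The entries of the matrix of the orthogonal projection onto a plane. These embed `G(k,n)` as a
real algebraic subset of the space of `n × n` matrices. -/
noncomputable def coord {k n : ℕ} (E : Grass k n) (ij : Fin n × Fin n) : ℝ :=
  ⟪EuclideanSpace.single ij.1 (1 : ℝ),
    E.space.starProjection (EuclideanSpace.single ij.2 (1 : ℝ))⟫

/-- A set of planes is generic if it contains a dense Zariski-open subset of `G(k,n)`, of the form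
`{E | P(E) ≠ 0}` with `P` a polynomial in the entries of the projection matrix. -/
def IsGeneric {k n : ℕ} (U : Set (Grass k n)) : Prop :=
  ∃ P : MvPolynomial (Fin n × Fin n) ℝ,
    Dense {E : Grass k n | MvPolynomial.eval E.coord P ≠ 0} ∧
      {E : Grass k n | MvPolynomial.eval E.coord P ≠ 0} ⊆ U

/-- The pairs `(x, y)` that are admissible at step `i` of the algorithm for principal vectors
between `E` and `F`, when `p j`, `q j` (for `j < i`) have been chosen. -/
def Admissible {k n : ℕ} (E F : Grass k n) (p q : Fin k → Euc n) (i : Fin k)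
    (x y : Euc n) : Prop :=
  (x ∈ E.space ∧ ‖x‖ = 1 ∧ ∀ j, j < i → ⟪x, p j⟫ = 0) ∧
    (y ∈ F.space ∧ ‖y‖ = 1 ∧ ∀ j, j < i → ⟪y, q j⟫ = 0)

/-- `(p 0, q 0), …, (p (k-1), q (k-1))` are principal vectors between `E` and `F`:
at every step the pair `(p i, q i)` maximizes the scalar product among the admissible pairs. -/
def IsPrincipalVectors {k n : ℕ} (E F : Grass k n) (p q : Fin k → Euc n) : Prop :=
  ∀ i, Admissible E F p q i (p i) (q i) ∧
    ∀ x y, Admissible E F p q i x y → ⟪x, y⟫ ≤ ⟪p i, q i⟫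

theorem exists_unit_orthogonal {n k : ℕ} (S : Submodule ℝ (Euc n))
    (p : Fin k → Euc n) (i : Fin k) (hS : (i : ℕ) < Module.finrank ℝ S) :
    ∃ x ∈ S, ‖x‖ = 1 ∧ ∀ j, j < i → ⟪x, p j⟫ = 0 := by
  let f : S →ₗ[ℝ] ({j : Fin k // j < i} → ℝ) :=
    LinearMap.pi fun j => (innerₛₗ ℝ (p j.1)).comp S.subtype
  have hcard : Module.finrank ℝ ({j : Fin k // j < i} → ℝ) = i := by
    rw [Module.finrank_pi, Fintype.card_subtype]
    have : (Finset.univ.filter fun j : Fin k => j < i) = Finset.Iio i := by ext; simp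
    rw [this, Fin.card_Iio]
  have hlt : Module.finrank ℝ ({j : Fin k // j < i} → ℝ) < Module.finrank ℝ S := by
    rw [hcard]; exact hS
  have hker := LinearMap.ker_ne_bot_of_finrank_lt (f := f) hlt
  obtain ⟨z, hz, hz0⟩ := Submodule.exists_mem_ne_zero_of_ne_bot hker
  have hz0' : (z : Euc n) ≠ 0 := by simpa using hz0
  refine ⟨‖(z : Euc n)‖⁻¹ • (z : Euc n), S.smul_mem _ z.2, ?_, ?_⟩
  · rw [norm_smul, norm_inv, norm_norm, inv_mul_cancel₀ (norm_ne_zero_iff.2 hz0')]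
  · intro j hj
    have h1 : f z ⟨j, hj⟩ = 0 := by rw [LinearMap.mem_ker.1 hz]; rfl
    have h2 : ⟪p j, (z : Euc n)⟫ = 0 := h1
    rw [real_inner_smul_left, real_inner_comm, h2, mul_zero]

theorem exists_best {k n : ℕ} (E F : Grass k n) (p q : Fin k → Euc n) (i : Fin k) :
    ∃ x y, Admissible E F p q i x y ∧ ∀ x' y', Admissible E F p q i x' y' → ⟪x', y'⟫ ≤ ⟪x, y⟫ := by
  have key : ∀ (G : Grass k n) (r : Fin k → Euc n),
      IsCompact {x : Euc n | x ∈ G.space ∧ ‖x‖ = 1 ∧ ∀ j, j < i → ⟪x, r j⟫ = 0} := by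
    intro G r
    refine (isCompact_sphere (0 : Euc n) 1).of_isClosed_subset ?_ ?_
    · have h1 : IsClosed {x : Euc n | x ∈ G.space} := G.space.closed_of_finiteDimensional
      have h2 : IsClosed {x : Euc n | ‖x‖ = 1} := isClosed_eq continuous_norm continuous_const
      have h3 : IsClosed {x : Euc n | ∀ j, j < i → ⟪x, r j⟫ = 0} := by
        simp only [Set.ofPred_forall]
        refine isClosed_iInter fun j => isClosed_iInter fun _ => ?_
        exact isClosed_eq (by fun_prop) continuous_const
      exact h1.inter (h2.inter h3)
    · intro x hx
      simpa using hx.2.1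
  have hne : ∀ (G : Grass k n) (r : Fin k → Euc n),
      {x : Euc n | x ∈ G.space ∧ ‖x‖ = 1 ∧ ∀ j, j < i → ⟪x, r j⟫ = 0}.Nonempty := by
    intro G r
    obtain ⟨x, h1, h2, h3⟩ := exists_unit_orthogonal G.space r i (by
      rw [G.finrank_space]; exact i.2)
    exact ⟨x, h1, h2, h3⟩
  obtain ⟨z, hz, hmax⟩ := ((key E p).prod (key F q)).exists_isMaxOn ((hne E p).prod (hne F q))
    (f := fun z : Euc n × Euc n => ⟪z.1, z.2⟫) (by fun_prop)
  exact ⟨z.1, z.2, ⟨hz.1, hz.2⟩, fun x' y' h => hmax (a := (x', y')) ⟨h.1, h.2⟩⟩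

theorem exists_isPrincipalVectors {k n : ℕ} (E F : Grass k n) :
    ∃ p q : Fin k → Euc n, IsPrincipalVectors E F p q := by
  have step : ∀ m : ℕ, m ≤ k → ∃ p q : Fin k → Euc n, ∀ i : Fin k, (i : ℕ) < m →
      (Admissible E F p q i (p i) (q i) ∧
        ∀ x y, Admissible E F p q i x y → ⟪x, y⟫ ≤ ⟪p i, q i⟫) := by
    intro m
    induction m with
    | zero => exact fun _ => ⟨0, 0, fun i hi => absurd hi (Nat.not_lt_zero _)⟩
    | succ m ih =>
      intro hm
      obtain ⟨p, q, h⟩ := ih (by omega)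
      let a : Fin k := ⟨m, hm⟩
      obtain ⟨x, y, hxy, hmax⟩ := exists_best E F p q a
      have hp : ∀ j : Fin k, (j : ℕ) < m → Function.update p a x j = p j := fun j hj =>
        Function.update_of_ne (by rintro rfl; exact lt_irrefl _ hj) _ _
      have hq : ∀ j : Fin k, (j : ℕ) < m → Function.update q a y j = q j := fun j hj =>
        Function.update_of_ne (by rintro rfl; exact lt_irrefl _ hj) _ _
      have hadm : ∀ i : Fin k, (i : ℕ) ≤ m → ∀ u v,
          (Admissible E F (Function.update p a x) (Function.update q a y) i u v ↔
            Admissible E F p q i u v) := by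
        intro i hi u v
        have e1 : ∀ j : Fin k, j < i → Function.update p a x j = p j := fun j hj =>
          hp j (lt_of_lt_of_le hj hi)
        have e2 : ∀ j : Fin k, j < i → Function.update q a y j = q j := fun j hj =>
          hq j (lt_of_lt_of_le hj hi)
        unfold Admissible
        refine and_congr (and_congr Iff.rfl (and_congr Iff.rfl ?_))
          (and_congr Iff.rfl (and_congr Iff.rfl ?_))
        · exact forall_congr' fun j => forall_congr' fun hj => by rw [e1 j hj]
        · exact forall_congr' fun j => forall_congr' fun hj => by rw [e2 j hj]
      refine ⟨Function.update p a x, Function.update q a y, fun i hi => ?_⟩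
      rcases Nat.lt_succ_iff_lt_or_eq.1 hi with hlt | heq
      · simp only [hadm i hlt.le, hp i hlt, hq i hlt]
        exact h i hlt
      · have hia : i = a := Fin.ext heq
        rw [hia]
        simp only [hadm a le_rfl, Function.update_self]
        exact ⟨hxy, hmax⟩
  obtain ⟨p, q, h⟩ := step k le_rfl
  exact ⟨p, q, fun i => h i i.2⟩

/-- The principal angles between `E` and `F`, in nondecreasing order: `principalAngle E F i` is
`arccos ⟪p i, q i⟫` for principal vectors `p, q` between `E` and `F`. By `principalAngle_eq` below
it does not depend on their choice. -/
noncomputable def principalAngle {k n : ℕ} (E F : Grass k n) (i : Fin k) : ℝ :=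
  Real.arccos ⟪(exists_isPrincipalVectors E F).choose i,
    (exists_isPrincipalVectors E F).choose_spec.choose i⟫

namespace IsPrincipalVectors

variable {k n : ℕ} {E F : Grass k n} {p q : Fin k → Euc n}

theorem symm (h : IsPrincipalVectors E F p q) : IsPrincipalVectors F E q p := fun i =>
  ⟨⟨(h i).1.2, (h i).1.1⟩, fun x y hxy => by
    rw [real_inner_comm, real_inner_comm (p i)]; exact (h i).2 y x ⟨hxy.2, hxy.1⟩⟩

theorem orthonormal_left (h : IsPrincipalVectors E F p q) : Orthonormal ℝ p := by
  refine ⟨fun i => (h i).1.1.2.1, fun i j hij => ?_⟩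
  rcases lt_or_gt_of_ne hij with hlt | hlt
  · rw [real_inner_comm]; exact (h j).1.1.2.2 i hlt
  · exact (h i).1.1.2.2 j hlt

theorem nonneg (h : IsPrincipalVectors E F p q) (i : Fin k) : 0 ≤ ⟪p i, q i⟫ := by
  have := (h i).2 (-(p i)) (q i) ⟨⟨E.space.neg_mem (h i).1.1.1, by rw [norm_neg]; exact (h i).1.1.2.1,
    fun j hj => by rw [inner_neg_left, (h i).1.1.2.2 j hj, neg_zero]⟩, (h i).1.2⟩
  rw [inner_neg_left] at this
  linarith

theorem antitone (h : IsPrincipalVectors E F p q) {i j : Fin k} (hij : i ≤ j) :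
    ⟪p j, q j⟫ ≤ ⟪p i, q i⟫ :=
  (h i).2 _ _ ⟨⟨(h j).1.1.1, (h j).1.1.2.1, fun l hl => (h j).1.1.2.2 l (hl.trans_le hij)⟩,
    ⟨(h j).1.2.1, (h j).1.2.2.1, fun l hl => (h j).1.2.2.2 l (hl.trans_le hij)⟩⟩

theorem inner_eq_zero_of_orthogonal (h : IsPrincipalVectors E F p q) (i : Fin k) {v : Euc n}
    (hv : v ∈ E.space) (hvp : ∀ j, j ≤ i → ⟪v, p j⟫ = 0) : ⟪v, q i⟫ = 0 := by
  have hc := h.nonneg i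
  have main : ∀ t : ℝ, ⟪p i, q i⟫ + t * ⟪v, q i⟫ ≤ ⟪p i, q i⟫ * Real.sqrt (1 + t ^ 2 * ‖v‖ ^ 2) := by
    intro t
    set w := p i + t • v with hw
    have hn : ‖w‖ ^ 2 = 1 + t ^ 2 * ‖v‖ ^ 2 := by
      rw [hw, norm_add_sq_real, real_inner_smul_right, real_inner_comm, hvp i le_rfl,
        (h i).1.1.2.1, norm_smul, mul_pow, Real.norm_eq_abs, sq_abs]
      ring
    have hpos : 0 < ‖w‖ := by
      have : 0 < ‖w‖ ^ 2 := by rw [hn]; positivity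
      exact lt_of_le_of_ne (norm_nonneg _) fun h0 => by rw [← h0] at this; norm_num at this
    have hs : Real.sqrt (1 + t ^ 2 * ‖v‖ ^ 2) = ‖w‖ := by
      rw [← hn, Real.sqrt_sq hpos.le]
    have hadm := (h i).2 (‖w‖⁻¹ • w) (q i) ⟨⟨E.space.smul_mem _
      (E.space.add_mem (h i).1.1.1 (E.space.smul_mem _ hv)), by
        rw [norm_smul, norm_inv, norm_norm, inv_mul_cancel₀ hpos.ne'], fun j hj => by
        rw [real_inner_smul_left, hw, inner_add_left, real_inner_smul_left, hvp j hj.le,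
          (h i).1.1.2.2 j hj]; simp⟩, (h i).1.2⟩
    rw [real_inner_smul_left, inv_mul_le_iff₀ hpos] at hadm
    rw [hs, mul_comm _ ‖w‖]
    refine le_trans (le_of_eq ?_) hadm
    rw [hw, inner_add_left, real_inner_smul_left]
  by_contra hne
  set b := ⟪v, q i⟫ with hb
  set c := ⟪p i, q i⟫ with hcdef
  set N := ‖v‖ ^ 2 with hN
  have hN0 : 0 ≤ N := by positivity
  have hb2 : 0 < b ^ 2 := by positivity
  have hden : 0 < c * N + 1 := by positivity
  have h1 := main (b / (c * N + 1))
  have h2 : Real.sqrt (1 + (b / (c * N + 1)) ^ 2 * N) ≤ 1 + (b / (c * N + 1)) ^ 2 * N / 2 := by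
    have h0 : 0 ≤ (b / (c * N + 1)) ^ 2 * N := by positivity
    rw [Real.sqrt_le_left (by positivity)]
    nlinarith [sq_nonneg ((b / (c * N + 1)) ^ 2 * N)]
  have h3 := mul_le_mul_of_nonneg_left h2 hc
  have h4 : b / (c * N + 1) * b ≤ c * ((b / (c * N + 1)) ^ 2 * N / 2) := by linarith
  have h5 : b / (c * N + 1) * b = b ^ 2 / (c * N + 1) := by ring
  have h6 : c * ((b / (c * N + 1)) ^ 2 * N / 2)
      = b ^ 2 / (c * N + 1) * ((c * N) / (2 * (c * N + 1))) := by
    field_simp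
  rw [h5, h6] at h4
  have h7 : 0 < b ^ 2 / (c * N + 1) := by positivity
  have h8 : (c * N) / (2 * (c * N + 1)) < 1 := by
    rw [div_lt_one (by positivity)]
    nlinarith [mul_nonneg hc hN0]
  nlinarith

theorem inner_eq_zero (h : IsPrincipalVectors E F p q) {i j : Fin k} (hij : i ≠ j) :
    ⟪p i, q j⟫ = 0 := by
  rcases lt_or_gt_of_ne hij with hlt | hlt
  · rw [real_inner_comm]
    refine h.symm.inner_eq_zero_of_orthogonal i (h j).1.2.1 fun l hl => ?_
    exact (h j).1.2.2.2 l (hl.trans_lt hlt)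
  · exact h.inner_eq_zero_of_orthogonal j (h i).1.1.1 fun l hl =>
      (h i).1.1.2.2 l (hl.trans_lt hlt)

theorem inner_right_eq (h : IsPrincipalVectors E F p q) (j : Fin k) {x : Euc n}
    (hx : x ∈ E.space) : ⟪x, q j⟫ = ⟪x, p j⟫ * ⟪p j, q j⟫ := by
  have hspan : Submodule.span ℝ (Set.range p) = E.space := by
    refine Submodule.eq_of_le_of_finrank_eq
      (Submodule.span_le.2 (by rintro _ ⟨i, rfl⟩; exact (h i).1.1.1)) ?_
    rw [finrank_span_eq_card h.orthonormal_left.linearIndependent, E.finrank_space,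
      Fintype.card_fin]
  rw [← hspan] at hx
  induction hx using Submodule.span_induction with
  | mem x hx =>
    obtain ⟨i, rfl⟩ := hx
    by_cases hij : i = j
    · subst hij
      rw [real_inner_self_eq_norm_sq, (h i).1.1.2.1]; ring
    · rw [h.inner_eq_zero hij, h.orthonormal_left.2 hij, zero_mul]
  | zero => simp
  | add x y _ _ hx hy => rw [inner_add_left, inner_add_left, hx, hy]; ring
  | smul a x _ hx => rw [real_inner_smul_left, real_inner_smul_left, hx]; ring

theorem inner_le (h : IsPrincipalVectors E F p q) {p' q' : Fin k → Euc n}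
    (h' : IsPrincipalVectors E F p' q') (i : Fin k) : ⟪p' i, q' i⟫ ≤ ⟪p i, q i⟫ := by
  let P' : {j : Fin k // j ≤ i} → Euc n := fun j => p' j.1
  let Q' : {j : Fin k // j ≤ i} → Euc n := fun j => q' j.1
  have hP' : Orthonormal ℝ P' := h'.orthonormal_left.comp _ Subtype.val_injective
  have hQ' : Orthonormal ℝ Q' := h'.symm.orthonormal_left.comp _ Subtype.val_injective
  have hcard : Fintype.card {j : Fin k // j ≤ i} = i + 1 := by
    rw [Fintype.card_subtype]
    have : (Finset.univ.filter fun j : Fin k => j ≤ i) = Finset.Iic i := by ext; simp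
    rw [this, Fin.card_Iic]
  obtain ⟨x, hxS, hx1, hxo⟩ := exists_unit_orthogonal (Submodule.span ℝ (Set.range P')) p i (by
    rw [finrank_span_eq_card hP'.linearIndependent, hcard]; exact Nat.lt_succ_self _)
  have hPE : Submodule.span ℝ (Set.range P') ≤ E.space :=
    Submodule.span_le.2 (by rintro _ ⟨j, rfl⟩; exact (h' j.1).1.1.1)
  have hxE : x ∈ E.space := hPE hxS
  obtain ⟨a, ha⟩ := (Submodule.mem_span_range_iff_exists_fun ℝ).1 hxS
  have hsum : ∑ j, a j ^ 2 = 1 := by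
    have : ⟪x, x⟫ = 1 := by rw [real_inner_self_eq_norm_sq, hx1]; norm_num
    rw [← ha, hP'.inner_sum] at this
    simpa [sq] using this
  -- The orthogonal projection of `x` to `F`.
  set y := F.space.starProjection x with hy
  have hyF : y ∈ F.space := F.space.starProjection_apply_mem x
  have hyin : ∀ z ∈ F.space, ⟪y, z⟫ = ⟪x, z⟫ := by
    intro z hz
    have := F.space.starProjection_inner_eq_zero x z hz
    rw [inner_sub_left] at this
    linarith
  have hinner : ∀ j : {j : Fin k // j ≤ i}, ⟪x, Q' j⟫ = a j * ⟪p' j.1, q' j.1⟫ := by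
    intro j
    have h1 : ⟪x, p' j.1⟫ = a j := by
      have h2 := hP'.inner_left_fintype a j
      rw [ha] at h2
      simpa using h2
    rw [show Q' j = q' j.1 from rfl, h'.inner_right_eq j.1 hxE, h1]
  have hc' := h'.nonneg i
  have hbound : ⟪p' i, q' i⟫ ^ 2 ≤ ‖y‖ ^ 2 := by
    have hb := hQ'.sum_inner_products_le y (s := Finset.univ)
    refine le_trans ?_ hb
    have : ∀ j : {j : Fin k // j ≤ i},
        a j ^ 2 * ⟪p' i, q' i⟫ ^ 2 ≤ ‖⟪Q' j, y⟫‖ ^ 2 := by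
      intro j
      rw [real_inner_comm y (Q' j), hyin (Q' j) (h' j.1).1.2.1, hinner j, Real.norm_eq_abs, sq_abs, mul_pow]
      have := h'.antitone j.2
      gcongr
    calc ⟪p' i, q' i⟫ ^ 2 = ∑ j, a j ^ 2 * ⟪p' i, q' i⟫ ^ 2 := by
          rw [← Finset.sum_mul, hsum, one_mul]
      _ ≤ _ := Finset.sum_le_sum fun j _ => this j
  have hle : ⟪p' i, q' i⟫ ≤ ‖y‖ := by
    exact (pow_le_pow_iff_left₀ hc' (norm_nonneg _) two_ne_zero).1 hbound
  refine hle.trans ?_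
  rcases (norm_nonneg y).eq_or_lt with h0 | hpos
  · rw [← h0]; exact h.nonneg i
  · have hadm := (h i).2 x (‖y‖⁻¹ • y) ⟨⟨hxE, hx1, hxo⟩, ⟨F.space.smul_mem _ hyF, by
      rw [norm_smul, norm_inv, norm_norm, inv_mul_cancel₀ hpos.ne'], fun j hj => by
      rw [real_inner_smul_left, hyin _ (h j).1.2.1, h.inner_right_eq j hxE, hxo j hj]; simp⟩⟩
    refine le_trans (le_of_eq ?_) hadm
    rw [real_inner_smul_right, hyin y hyF |>.symm, real_inner_self_eq_norm_sq]
    field_simp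

end IsPrincipalVectors

theorem principalAngle_eq {k n : ℕ} {E F : Grass k n} {p q : Fin k → Euc n}
    (h : IsPrincipalVectors E F p q) (i : Fin k) :
    principalAngle E F i = Real.arccos ⟪p i, q i⟫ := by
  have h0 := (exists_isPrincipalVectors E F).choose_spec.choose_spec
  unfold principalAngle
  rw [le_antisymm (h.inner_le h0 i) (h0.inner_le h i)]

/-- The Grassmann distance `δ(E,F) = (θ₁² + ⋯ + θ_k²)^{1/2}`, where `θ₁, …, θ_k` are the principal
angles between `E` and `F`. -/
noncomputable def dist {k n : ℕ} (E F : Grass k n) : ℝ :=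
  Real.sqrt (∑ i, principalAngle E F i ^ 2)

/-- The simple Schubert variety `Ω_s(W) = {E | dim (E ∩ W) ≥ s}`. -/
def schubert {k n : ℕ} (W : Grass k n) (s : ℕ) : Set (Grass k n) :=
  {E | s ≤ Module.finrank ℝ (E.space ⊓ W.space : Submodule ℝ (Euc n))}

/-- The planes `L` with `0 < θ₁(L) < ⋯ < θ_k(L) < π/2`, where the `θ_i(L)` are the principal angles
between `L` and `W`. -/
def regularPlanes {k n : ℕ} (W : Grass k n) : Set (Grass k n) :=
  {L | (∀ i, 0 < principalAngle L W i) ∧ StrictMono (principalAngle L W) ∧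
    ∀ i, principalAngle L W i < Real.pi / 2}

/-- The set of global maximizers on `Ω_s(W)` of the distance from `L`. -/
def maximizers {k n : ℕ} (L W : Grass k n) (s : ℕ) : Set (Grass k n) :=
  {E | E ∈ schubert W s ∧ IsMaxOn (fun E' => dist L E') (schubert W s) E}

end Grass

/-!
Maximizing `δ_L` on `Ω_s` amounts to minimizing the overlap `tr (P_L P_E) = ∑ cos² θ_i(L, E)`.
If `dim (E ∩ W) ≥ s`, a dimension count gives `θ_i(L, E) ≤ θ_{k-s+i}(L, W)`, so each angle has its
own upper bound, with `π/2` for the last `k - s` of them. Hence the distance is bounded by the value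
in the theorem, and both the distance and the overlap are extremal exactly when all these
inequalities are equalities.

The overlap is additive over orthogonal sums. An `s`-plane of `W` has overlap at least
`cos² θ_{k-s+1} + ⋯ + cos² θ_k` with `L` (Ky Fan), and when `θ_{k-s} < θ_{k-s+1}` only `E_W` attains
this value. So `E` is extremal if and only if it contains `E_W` and the rest of `E` is orthogonal
to `L`.

For genericity, the compression of `P_L` to `W` has characteristic polynomial `∏ (X - cos² θ_i)`,
whose coefficients are polynomials in the entries of `P_L`; `P` is its resultant with its derivative
times its values at `0` and `1`. Principal vectors provide an analytic curve joining any two planes,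
along which `P` vanishes only at isolated points unless it vanishes identically.
-/

section Overlap

variable {V : Type*} [NormedAddCommGroup V] [InnerProductSpace ℝ V] [FiniteDimensional ℝ V]
  {ι : Type*} [Fintype ι] {S T : Submodule ℝ V} {u : ι → V}

theorem exists_orthonormal_span_range_eq (S : Submodule ℝ V) {d : ℕ}
    (hd : Module.finrank ℝ S = d) :
    ∃ u : Fin d → V, Orthonormal ℝ u ∧ Submodule.span ℝ (Set.range u) = S := by
  subst hd
  let b := stdOrthonormalBasis ℝ S
  refine ⟨S.subtype ∘ b, b.orthonormal.comp_linearIsometry S.subtypeₗᵢ, ?_⟩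
  rw [Set.range_comp, Submodule.span_image, ← b.coe_toBasis, b.toBasis.span_eq,
    Submodule.map_top, Submodule.range_subtype]

theorem starProjection_span_range (hu : Orthonormal ℝ u) :
    (Submodule.span ℝ (Set.range u)).starProjection =
      ∑ i, InnerProductSpace.rankOne ℝ (u i) (u i) := by
  have hspan : ⇑(Module.Basis.span hu.linearIndependent) =
      fun i ↦ ⟨u i, Submodule.subset_span (Set.mem_range_self i)⟩ :=
    funext (Module.Basis.span_apply hu.linearIndependent)
  let b := (Module.Basis.span hu.linearIndependent).toOrthonormalBasis
    (hspan ▸ orthonormal_span hu)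
  have hb (i : ι) : (b i : V) = u i := by simp [b]
  simpa only [hb] using b.starProjection_eq_sum_rankOne

omit [FiniteDimensional ℝ V] in
theorem real_inner_starProjection_self (S : Submodule ℝ V) [S.HasOrthogonalProjection] (x : V) :
    ⟪S.starProjection x, x⟫ = ‖S.starProjection x‖ ^ 2 := by
  simpa using Submodule.re_inner_starProjection_eq_normSq (𝕜 := ℝ) (K := S) x

theorem inner_starProjection_span_range (hu : Orthonormal ℝ u) (x y : V) :
    ⟪x, (Submodule.span ℝ (Set.range u)).starProjection y⟫ = ∑ i, ⟪u i, x⟫ * ⟪u i, y⟫ := by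
  simp [starProjection_span_range hu, inner_sum, real_inner_smul_right, real_inner_comm, mul_comm]

theorem norm_sq_starProjection_span_range (hu : Orthonormal ℝ u) (x : V) :
    ‖(Submodule.span ℝ (Set.range u)).starProjection x‖ ^ 2 = ∑ i, ⟪u i, x⟫ ^ 2 := by
  rw [← real_inner_starProjection_self, real_inner_comm, inner_starProjection_span_range hu]
  simp only [sq]

theorem starProjection_sup_of_isOrtho (h : S ⟂ T) :
    (S ⊔ T).starProjection = S.starProjection + T.starProjection := by
  ext x
  refine Submodule.eq_starProjection_of_mem_of_inner_eq_zero ?_ fun w hw ↦ ?_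
  · exact Submodule.add_mem_sup (S.starProjection_apply_mem x) (T.starProjection_apply_mem x)
  obtain ⟨y, hy, z, hz, rfl⟩ := Submodule.mem_sup.1 hw
  have hyS := S.starProjection_inner_eq_zero x y hy
  have hzT := T.starProjection_inner_eq_zero x z hz
  have hyT := h.symm.inner_eq (T.starProjection_apply_mem x) hy
  have hzS := h.inner_eq (S.starProjection_apply_mem x) hz
  simp only [add_apply, inner_sub_left, inner_add_left, inner_add_right] at *
  linarith

/-- The overlap of two subspaces: the trace of the product of the orthogonal projections onto
them. For planes in the Grassmannian it is the sum of the squared cosines of the principal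
angles. -/
noncomputable def overlap (S T : Submodule ℝ V) : ℝ :=
  LinearMap.trace ℝ V ((S.starProjection * T.starProjection : V →L[ℝ] V) : V →ₗ[ℝ] V)

theorem overlap_comm (S T : Submodule ℝ V) : overlap S T = overlap T S :=
  LinearMap.trace_mul_comm ℝ (S.starProjection : V →ₗ[ℝ] V) (T.starProjection : V →ₗ[ℝ] V)

theorem overlap_sup_of_isOrtho (L : Submodule ℝ V) (h : S ⟂ T) :
    overlap L (S ⊔ T) = overlap L S + overlap L T := by
  simp only [overlap, starProjection_sup_of_isOrtho h, mul_add,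
    ContinuousLinearMap.toLinearMap_add, map_add]

theorem overlap_span_range (S : Submodule ℝ V) (hu : Orthonormal ℝ u) :
    overlap S (Submodule.span ℝ (Set.range u)) = ∑ i, ‖S.starProjection (u i)‖ ^ 2 := by
  rw [overlap, starProjection_span_range hu, Finset.mul_sum]
  simp only [ContinuousLinearMap.mul_def, InnerProductSpace.comp_rankOne,
    ContinuousLinearMap.toLinearMap_sum, map_sum, InnerProductSpace.trace_rankOne]
  simp only [← real_inner_starProjection_self, real_inner_comm]

theorem overlap_nonneg (S T : Submodule ℝ V) : 0 ≤ overlap S T := by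
  obtain ⟨u, hu, hT⟩ := exists_orthonormal_span_range_eq T rfl
  rw [← hT, overlap_span_range S hu]
  positivity

theorem overlap_eq_finrank_of_le (h : T ≤ S) : overlap S T = Module.finrank ℝ T := by
  obtain ⟨u, hu, hT⟩ := exists_orthonormal_span_range_eq T rfl
  rw [← hT, overlap_span_range S hu]
  have hnorm (i) : ‖S.starProjection (u i)‖ = 1 := by
    rw [Submodule.starProjection_eq_self_iff.2 (h (hT ▸ Submodule.subset_span ⟨i, rfl⟩)), hu.1 i]
  simp [hnorm, finrank_span_eq_card hu.linearIndependent]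

theorem overlap_eq_zero_iff : overlap S T = 0 ↔ T ≤ Sᗮ := by
  obtain ⟨u, hu, hT⟩ := exists_orthonormal_span_range_eq T rfl
  rw [← hT, overlap_span_range S hu, Finset.sum_eq_zero_iff_of_nonneg fun i _ ↦ by positivity,
    Submodule.span_le, Set.range_subset_iff]
  simp [Submodule.starProjection_apply_eq_zero_iff]

end Overlap

theorem exists_le_finrank_eq {K M : Type*} [Ring K] [Nontrivial K] [StrongRankCondition K]
    [AddCommGroup M] [Module K M] (S : Submodule K M) {d : ℕ} (hd : d ≤ Module.finrank K S) :
    ∃ T ≤ S, Module.finrank K T = d := by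
  obtain ⟨f, hf⟩ := exists_linearIndependent_of_le_finrank hd
  refine ⟨Submodule.span K (Set.range (S.subtype ∘ f)), ?_, ?_⟩
  · rw [Submodule.span_le]
    rintro _ ⟨i, rfl⟩
    exact (f i).2
  · rw [finrank_span_eq_card (hf.map' S.subtype S.ker_subtype), Fintype.card_fin]

theorem eq_zero_of_sum_mul_le_sum {ι : Type*} [Fintype ι] {J : Finset ι} {c w : ι → ℝ}
    (hgap : ∀ i ∈ J, ∀ j ∉ J, c i < c j) (hw_nonneg : ∀ i, 0 ≤ w i) (hw_le_one : ∀ i, w i ≤ 1)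
    (hw_sum : ∑ i, w i = J.card) (hle : ∑ i, c i * w i ≤ ∑ i ∈ J, c i) {j : ι} (hj : j ∉ J) :
    w j = 0 := by
  classical
  obtain ⟨m, hm_gt, hm_lt⟩ := Order.exists_between_finsets (lo := J.image c) (hi := Jᶜ.image c)
    (by simpa using fun i hi j hj ↦ hgap i hi j hj)
  replace hm_gt (i) (hi : i ∈ J) : c i < m := hm_gt _ (Finset.mem_image_of_mem c hi)
  replace hm_lt (i) (hi : i ∉ J) : m < c i :=
    hm_lt _ (Finset.mem_image_of_mem c (Finset.mem_compl.2 hi))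
  have hterm (i) : 0 ≤ (c i - m) * (w i - if i ∈ J then 1 else 0) := by
    split_ifs with hi
    · exact mul_nonneg_of_nonpos_of_nonpos (by linarith [hm_gt i hi]) (by linarith [hw_le_one i])
    · exact mul_nonneg (by linarith [hm_lt i hi]) (by linarith [hw_nonneg i])
  have hsum : ∑ i, (c i - m) * (w i - if i ∈ J then 1 else 0) ≤ 0 := by
    calc
      _ = ∑ i, c i * w i - ∑ i ∈ J, c i - m * (∑ i, w i - J.card) := by
        simp only [mul_sub, sub_mul, mul_ite, mul_one, mul_zero, Finset.sum_sub_distrib,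
          Finset.sum_ite_mem, Finset.univ_inter, Finset.sum_const, nsmul_eq_mul, Finset.mul_sum]
        ring
      _ ≤ 0 := by
        rw [hw_sum]
        linarith
  have hzero := (Finset.sum_eq_zero_iff_of_nonneg fun i _ ↦ hterm i).1
    (le_antisymm hsum (Finset.sum_nonneg fun i _ ↦ hterm i)) j (Finset.mem_univ j)
  simpa [hj, (hm_lt j hj).ne', sub_eq_zero] using hzero

theorem finrank_span_image_eq_card {K M ι : Type*} [Ring K] [Nontrivial K]
    [StrongRankCondition K] [AddCommGroup M] [Module K M] {u : ι → M} (hu : LinearIndependent K u)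
    (J : Finset ι) : Module.finrank K (Submodule.span K (u '' J)) = J.card := by
  rw [Set.image_eq_range, ← Fintype.card_coe]
  exact finrank_span_eq_card (hu.comp _ Subtype.val_injective)

theorem inner_eq_zero_of_mem_span_image {V ι : Type*} [NormedAddCommGroup V]
    [InnerProductSpace ℝ V] {u : ι → V} (hu : Orthonormal ℝ u) {J : Set ι} {i : ι} (hi : i ∉ J)
    {x : V} (hx : x ∈ Submodule.span ℝ (u '' J)) : ⟪u i, x⟫ = 0 := by
  obtain ⟨l, hl, rfl⟩ := (Finsupp.mem_span_image_iff_linearCombination ℝ).1 hx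
  rw [real_inner_comm, hu.inner_finsupp_eq_zero hi hl]

theorem finrank_sup_of_disjoint {K M : Type*} [DivisionRing K] [AddCommGroup M] [Module K M]
    [FiniteDimensional K M] {S T : Submodule K M} (h : Disjoint S T) :
    Module.finrank K (S ⊔ T : Submodule K M) = Module.finrank K S + Module.finrank K T := by
  have hsum := Submodule.finrank_sup_add_finrank_inf_eq S T
  rwa [h.eq_bot, finrank_bot, add_zero] at hsum

namespace Grass

variable {k n : ℕ} {E F L W : Grass k n} {p q p' q' : Fin k → Euc n}

theorem principalAngle_mem_Icc (E F : Grass k n) (i : Fin k) :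
    principalAngle E F i ∈ Set.Icc 0 (Real.pi / 2) := by
  obtain ⟨p, q, h⟩ := exists_isPrincipalVectors E F
  rw [principalAngle_eq h]
  exact ⟨Real.arccos_nonneg _, Real.arccos_le_pi_div_two.2 (h.nonneg i)⟩

theorem span_range_eq_space (hp : Orthonormal ℝ p) (hpE : ∀ i, p i ∈ E.space) :
    Submodule.span ℝ (Set.range p) = E.space := by
  refine Submodule.eq_of_le_of_finrank_eq (Submodule.span_le.2 (Set.range_subset_iff.2 hpE)) ?_
  rw [finrank_span_eq_card hp.linearIndependent, E.finrank_space, Fintype.card_fin]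

namespace IsPrincipalVectors

theorem orthonormal_right (h : IsPrincipalVectors E F p q) : Orthonormal ℝ q :=
  h.symm.orthonormal_left

theorem mem_left (h : IsPrincipalVectors E F p q) (i : Fin k) : p i ∈ E.space := (h i).1.1.1

theorem mem_right (h : IsPrincipalVectors E F p q) (i : Fin k) : q i ∈ F.space := h.symm.mem_left i

theorem span_range_left (h : IsPrincipalVectors E F p q) :
    Submodule.span ℝ (Set.range p) = E.space :=
  span_range_eq_space h.orthonormal_left h.mem_left

theorem span_range_right (h : IsPrincipalVectors E F p q) :
    Submodule.span ℝ (Set.range q) = F.space :=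
  h.symm.span_range_left

theorem inner_le_one (h : IsPrincipalVectors E F p q) (i : Fin k) : ⟪p i, q i⟫ ≤ 1 := by
  simpa [h.orthonormal_left.1 i, h.orthonormal_right.1 i] using real_inner_le_norm (p i) (q i)

theorem cos_principalAngle (h : IsPrincipalVectors E F p q) (i : Fin k) :
    Real.cos (principalAngle E F i) = ⟪p i, q i⟫ := by
  rw [principalAngle_eq h, Real.cos_arccos (by linarith [h.nonneg i]) (h.inner_le_one i)]

theorem inner_left_eq (h : IsPrincipalVectors E F p q) (i : Fin k) {y : Euc n}
    (hy : y ∈ F.space) : ⟪p i, y⟫ = ⟪p i, q i⟫ * ⟪q i, y⟫ := by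
  rw [real_inner_comm, h.symm.inner_right_eq i hy, real_inner_comm (p i), real_inner_comm, mul_comm]

theorem norm_sq_starProjection (h : IsPrincipalVectors E F p q) {y : Euc n} (hy : y ∈ F.space) :
    ‖E.space.starProjection y‖ ^ 2 = ∑ i, ⟪p i, q i⟫ ^ 2 * ⟪q i, y⟫ ^ 2 := by
  rw [← h.span_range_left, norm_sq_starProjection_span_range h.orthonormal_left]
  simp only [h.inner_left_eq _ hy, mul_pow]

theorem norm_sq_eq (h : IsPrincipalVectors E F p q) {y : Euc n} (hy : y ∈ F.space) :
    ‖y‖ ^ 2 = ∑ i, ⟪q i, y⟫ ^ 2 := by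
  rw [← norm_sq_starProjection_span_range h.orthonormal_right, h.span_range_right,
    Submodule.starProjection_eq_self_iff.2 hy]

theorem norm_sq_starProjection_right (h : IsPrincipalVectors E F p q) (i : Fin k) :
    ‖E.space.starProjection (q i)‖ ^ 2 = ⟪p i, q i⟫ ^ 2 := by
  classical
  simp [h.norm_sq_starProjection (h.mem_right i), orthonormal_iff_ite.1 h.orthonormal_right]

theorem norm_sq_starProjection_le (h : IsPrincipalVectors E F p q) {y : Euc n} (hy : y ∈ F.space)
    (i : Fin k) (hyq : ∀ j < i, ⟪y, q j⟫ = 0) :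
    ‖E.space.starProjection y‖ ^ 2 ≤ ⟪p i, q i⟫ ^ 2 * ‖y‖ ^ 2 := by
  rw [h.norm_sq_starProjection hy, h.norm_sq_eq hy, Finset.mul_sum]
  refine Finset.sum_le_sum fun j _ ↦ ?_
  rcases lt_or_ge j i with hj | hj
  · simp [real_inner_comm, hyq j hj]
  · have := h.antitone hj
    have := h.nonneg j
    gcongr

theorem le_norm_sq_starProjection (h : IsPrincipalVectors E F p q) (i : Fin k) {y : Euc n}
    (hy : y ∈ Submodule.span ℝ (q '' Set.Iic i)) :
    ⟪p i, q i⟫ ^ 2 * ‖y‖ ^ 2 ≤ ‖E.space.starProjection y‖ ^ 2 := by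
  have hyF : y ∈ F.space :=
    h.span_range_right ▸ Submodule.span_mono (Set.image_subset_range _ _) hy
  rw [h.norm_sq_starProjection hyF, h.norm_sq_eq hyF, Finset.mul_sum]
  refine Finset.sum_le_sum fun j _ ↦ ?_
  rcases le_or_gt j i with hj | hj
  · have := h.antitone hj
    have := h.nonneg i
    gcongr
  · simp [inner_eq_zero_of_mem_span_image h.orthonormal_right (Set.notMem_Iic.2 hj) hy]

theorem inner_le_inner_of_le_finrank_inf (h' : IsPrincipalVectors L E p' q')
    (h : IsPrincipalVectors L W p q) {i j : Fin k}
    (hij : k + i ≤ Module.finrank ℝ (E.space ⊓ W.space : Submodule ℝ (Euc n)) + j) :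
    ⟪p j, q j⟫ ≤ ⟪p' i, q' i⟫ := by
  have hspan : Submodule.span ℝ (q '' Set.Iic j) ≤ W.space :=
    (Submodule.span_mono (Set.image_subset_range _ _)).trans h.span_range_right.le
  have hfinrank : Module.finrank ℝ (Submodule.span ℝ (q '' Set.Iic j)) = j + 1 := by
    rw [← Finset.coe_Iic, finrank_span_image_eq_card h.orthonormal_right.linearIndependent,
      Fin.card_Iic]
  have hdim := Submodule.finrank_sup_add_finrank_inf_eq (E.space ⊓ W.space)
    (Submodule.span ℝ (q '' Set.Iic j))
  have hsup := (Submodule.finrank_mono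
    (sup_le (inf_le_right : E.space ⊓ W.space ≤ W.space) hspan)).trans_eq W.finrank_space
  obtain ⟨x, ⟨hxEW, hxspan⟩, hx, hxq⟩ := exists_unit_orthogonal
    (E.space ⊓ W.space ⊓ Submodule.span ℝ (q '' Set.Iic j)) q' i (by omega)
  have hle := (h.le_norm_sq_starProjection j hxspan).trans
    (h'.norm_sq_starProjection_le hxEW.1 i hxq)
  rw [hx, one_pow, mul_one, mul_one] at hle
  exact (sq_le_sq₀ (h.nonneg j) (h'.nonneg i)).1 hle

theorem inner_right_eq_zero (h : IsPrincipalVectors L W p q) {i : Fin k}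
    (hi : 0 < principalAngle L W i) {x : Euc n} (hxL : x ∈ L.space) (hxW : x ∈ W.space) :
    ⟪q i, x⟫ = 0 := by
  have hlt : ⟪p i, q i⟫ < 1 := by
    rwa [principalAngle_eq h, Real.arccos_pos] at hi
  have hself : ⟪q i, x⟫ = ⟪p i, q i⟫ ^ 2 * ⟪q i, x⟫ :=
    calc
      ⟪q i, x⟫ = ⟪p i, x⟫ * ⟪p i, q i⟫ := by
        rw [real_inner_comm, h.inner_right_eq i hxL, real_inner_comm]
      _ = ⟪p i, q i⟫ ^ 2 * ⟪q i, x⟫ := by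
        rw [h.inner_left_eq i hxW]
        ring
  have := pow_lt_one₀ (h.nonneg i) hlt two_ne_zero
  exact (mul_left_eq_self₀.1 hself.symm).resolve_left this.ne

end IsPrincipalVectors

theorem overlap_eq_sum_cos_sq (E F : Grass k n) :
    overlap E.space F.space = ∑ i, Real.cos (principalAngle E F i) ^ 2 := by
  obtain ⟨p, q, h⟩ := exists_isPrincipalVectors E F
  rw [← h.span_range_right, overlap_span_range _ h.orthonormal_right]
  simp only [h.norm_sq_starProjection_right, h.cos_principalAngle]

section MaximalDistance

variable {k n s : ℕ} {L W E : Grass k n} {p q : Fin k → Euc n}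

/-- The span of the last `s` vectors of a family; for principal vectors `(p, q)` between `L` and
`W` this is the plane `E_W` of the theorem. -/
def lastSpan (s : ℕ) (q : Fin k → Euc n) : Submodule ℝ (Euc n) :=
  Submodule.span ℝ (q '' {i : Fin k | k - s ≤ i.val})

/-- The largest value of the `i`-th principal angle between `L` and a plane of `schubert W s`. -/
noncomputable def farAngle (L W : Grass k n) (s : ℕ) (i : Fin k) : ℝ :=
  if h : i.val + (k - s) < k then principalAngle L W ⟨i + (k - s), h⟩ else Real.pi / 2

/-- The largest distance from `L` to a plane of `schubert W s`. -/
noncomputable def maxDist (L W : Grass k n) (s : ℕ) : ℝ :=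
  Real.sqrt ((∑ i : Fin k with k - s ≤ i.val, principalAngle L W i ^ 2)
    + ((k - s : ℕ) : ℝ) * (Real.pi / 2) ^ 2)

theorem card_filter_le_val (k m : ℕ) :
    (Finset.univ.filter fun i : Fin k ↦ m ≤ i.val).card = k - m := by
  simp only [← not_lt]
  have hcompl := Finset.card_filter_add_card_filter_not (s := Finset.univ)
    fun i : Fin k ↦ i.val < m
  rw [Fin.card_filter_val_lt, Finset.card_univ, Fintype.card_fin] at hcompl
  omega

theorem sum_farAngle (hsk : s ≤ k) (L W : Grass k n) (f : ℝ → ℝ) :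
    ∑ i, f (farAngle L W s i) = (∑ i : Fin k with k - s ≤ i.val, f (principalAngle L W i))
      + ((k - s : ℕ) : ℝ) * f (Real.pi / 2) := by
  rw [← Finset.sum_filter_add_sum_filter_not _ (fun i : Fin k ↦ i.val < s)]
  simp only [not_lt]
  congr 1
  · refine Finset.sum_bij' (fun i hi ↦ ⟨i + (k - s), by grind⟩)
      (fun i hi ↦ ⟨i - (k - s), by grind⟩) ?_ ?_ ?_ ?_ ?_ <;> grind [farAngle]
  · rw [← card_filter_le_val k s, ← nsmul_eq_mul, ← Finset.sum_const]
    exact Finset.sum_congr rfl (by grind [farAngle])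

theorem maxDist_eq (hsk : s ≤ k) (L W : Grass k n) :
    maxDist L W s = Real.sqrt (∑ i, farAngle L W s i ^ 2) := by
  rw [maxDist, sum_farAngle hsk L W (· ^ 2)]

theorem farAngle_mem_Icc (L W : Grass k n) (s : ℕ) (i : Fin k) :
    farAngle L W s i ∈ Set.Icc 0 (Real.pi / 2) := by
  rw [farAngle]
  split_ifs with h
  · exact principalAngle_mem_Icc L W _
  · exact Set.right_mem_Icc.2 Real.pi_div_two_pos.le

theorem principalAngle_le_farAngle (L : Grass k n) (hE : E ∈ schubert W s) (i : Fin k) :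
    principalAngle L E i ≤ farAngle L W s i := by
  rw [farAngle]
  split_ifs with h
  · obtain ⟨p, q, hpq⟩ := exists_isPrincipalVectors L W
    obtain ⟨p', q', hpq'⟩ := exists_isPrincipalVectors L E
    have hs : s ≤ Module.finrank ℝ (E.space ⊓ W.space : Submodule ℝ (Euc n)) := hE
    rw [principalAngle_eq hpq, principalAngle_eq hpq']
    refine Real.arccos_le_arccos (hpq'.inner_le_inner_of_le_finrank_inf hpq ?_)
    simp only
    omega
  · exact (principalAngle_mem_Icc L E i).2

theorem dist_le_maxDist (hsk : s ≤ k) (L : Grass k n) (hE : E ∈ schubert W s) :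
    dist L E ≤ maxDist L W s := by
  rw [maxDist_eq hsk]
  refine Real.sqrt_le_sqrt (Finset.sum_le_sum fun i _ ↦ ?_)
  exact pow_le_pow_left₀ (principalAngle_mem_Icc L E i).1 (principalAngle_le_farAngle L hE i) 2

theorem sum_principalAngle_eq_sum_farAngle_iff (L : Grass k n) (hE : E ∈ schubert W s) {f : ℝ → ℝ}
    (hf : StrictMonoOn f (Set.Icc 0 (Real.pi / 2))) :
    ∑ i, f (principalAngle L E i) = ∑ i, f (farAngle L W s i) ↔
      ∀ i, principalAngle L E i = farAngle L W s i := by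
  have hle (i) : f (principalAngle L E i) ≤ f (farAngle L W s i) :=
    hf.monotoneOn (principalAngle_mem_Icc L E i) (farAngle_mem_Icc L W s i)
      (principalAngle_le_farAngle L hE i)
  rw [Finset.sum_eq_sum_iff_of_le fun i _ ↦ hle i]
  simp only [Finset.mem_univ, true_imp_iff,
    hf.injOn.eq_iff (principalAngle_mem_Icc L E _) (farAngle_mem_Icc L W s _)]

theorem dist_eq_maxDist_iff (hsk : s ≤ k) (L : Grass k n) (hE : E ∈ schubert W s) :
    dist L E = maxDist L W s ↔ overlap L.space E.space =
      ∑ i : Fin k with k - s ≤ i.val, Real.cos (principalAngle L W i) ^ 2 := by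
  have hsq : StrictMonoOn (fun θ : ℝ ↦ θ ^ 2) (Set.Icc 0 (Real.pi / 2)) :=
    fun x hx y _ hxy ↦ pow_lt_pow_left₀ hxy hx.1 two_ne_zero
  have hcos : StrictMonoOn (fun θ ↦ -Real.cos θ ^ 2) (Set.Icc 0 (Real.pi / 2)) := by
    intro x hx y hy hxy
    have hlt := Real.cos_lt_cos_of_nonneg_of_le_pi_div_two hx.1 hy.2 hxy
    have hy_nonneg := Real.cos_nonneg_of_mem_Icc ⟨by linarith [hy.1, Real.pi_pos], hy.2⟩
    simpa using pow_lt_pow_left₀ hlt hy_nonneg two_ne_zero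
  have hsum := sum_farAngle hsk L W fun θ ↦ -Real.cos θ ^ 2
  simp only [Real.cos_pi_div_two] at hsum
  rw [dist, maxDist_eq hsk, Real.sqrt_inj (by positivity) (by positivity),
    sum_principalAngle_eq_sum_farAngle_iff L hE hsq,
    ← sum_principalAngle_eq_sum_farAngle_iff L hE hcos, hsum, overlap_eq_sum_cos_sq]
  simp

theorem overlap_lastSpan (h : IsPrincipalVectors L W p q) (s : ℕ) :
    overlap L.space (lastSpan s q) =
      ∑ i : Fin k with k - s ≤ i.val, Real.cos (principalAngle L W i) ^ 2 := by
  rw [lastSpan, ← Finset.coe_filter_univ, Set.image_eq_range]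
  refine (overlap_span_range L.space (h.orthonormal_right.comp _ Subtype.val_injective)).trans ?_
  simp only [Function.comp_apply, h.norm_sq_starProjection_right, ← h.cos_principalAngle]
  exact Finset.sum_coe_sort _ fun i ↦ Real.cos (principalAngle L W i) ^ 2

theorem finrank_lastSpan (hsk : s ≤ k) (hq : Orthonormal ℝ q) :
    Module.finrank ℝ (lastSpan s q) = s := by
  rw [lastSpan, ← Finset.coe_filter_univ, finrank_span_image_eq_card hq.linearIndependent,
    card_filter_le_val]
  omega

theorem lastSpan_le (h : IsPrincipalVectors L W p q) (s : ℕ) : lastSpan s q ≤ W.space :=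
  (Submodule.span_mono (Set.image_subset_range _ _)).trans_eq h.span_range_right

end MaximalDistance

section Maximizers

variable {k n s : ℕ} {L W E : Grass k n} {p q : Fin k → Euc n} {B V : Submodule ℝ (Euc n)}

theorem notMem_schubert {i : Fin k} (his : i.val < s) (hi : 0 < principalAngle L W i) :
    L ∉ schubert W s := by
  intro hL
  obtain ⟨p, q, h⟩ := exists_isPrincipalVectors L W
  obtain ⟨x, ⟨hxL, hxW⟩, hx, hxq⟩ := exists_unit_orthogonal _ q i (his.trans_le hL)
  have hle := h.norm_sq_starProjection_le hxW i hxq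
  rw [Submodule.starProjection_eq_self_iff.2 hxL, hx, one_pow, mul_one] at hle
  rw [principalAngle_eq h, Real.arccos_pos] at hi
  exact hle.not_gt (pow_lt_one₀ (h.nonneg i) hi two_ne_zero)

theorem overlap_eq_sum_of_le (h : IsPrincipalVectors L W p q) (hV : V ≤ W.space) :
    overlap L.space V =
      ∑ i, Real.cos (principalAngle L W i) ^ 2 * ‖V.starProjection (q i)‖ ^ 2 := by
  obtain ⟨u, hu, hspan⟩ := exists_orthonormal_span_range_eq V rfl
  have huW (a) : u a ∈ W.space := hV (hspan ▸ Submodule.subset_span ⟨a, rfl⟩)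
  rw [← hspan]
  simp only [overlap_span_range _ hu, norm_sq_starProjection_span_range hu,
    h.norm_sq_starProjection (huW _), h.cos_principalAngle, Finset.mul_sum]
  rw [Finset.sum_comm]
  simp only [real_inner_comm]

theorem le_lastSpan (h : IsPrincipalVectors L W p q) (hVW : V ≤ W.space)
    (hVq : ∀ i : Fin k, i.val < k - s → q i ∈ Vᗮ) : V ≤ lastSpan s q := by
  intro y hy
  have hsum : ∑ i, ⟪q i, y⟫ • q i = y := by
    have hyq := Submodule.starProjection_eq_self_iff.2 (h.span_range_right ▸ hVW hy)
    simpa only [starProjection_span_range h.orthonormal_right, sum_apply,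
      InnerProductSpace.rankOne_apply] using hyq
  rw [← hsum]
  refine Submodule.sum_mem _ fun i _ ↦ ?_
  rcases lt_or_ge i.val (k - s) with hi | hi
  · simp [Submodule.inner_left_of_mem_orthogonal hy (hVq i hi)]
  · exact Submodule.smul_mem _ _ (Submodule.subset_span ⟨i, hi, rfl⟩)

theorem eq_lastSpan_of_overlap_le (h : IsPrincipalVectors L W p q) (hsk : s ≤ k)
    (hgap : ∀ i j : Fin k, i.val < k - s → k - s ≤ j.val →
      principalAngle L W i < principalAngle L W j)
    (hVW : V ≤ W.space) (hV : Module.finrank ℝ V = s)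
    (hle : overlap L.space V ≤
      ∑ i : Fin k with k - s ≤ i.val, Real.cos (principalAngle L W i) ^ 2) :
    V = lastSpan s q := by
  refine Submodule.eq_of_le_of_finrank_eq (le_lastSpan h hVW fun j hj ↦ ?_)
    (hV.trans (finrank_lastSpan hsk h.orthonormal_right).symm)
  have hsum : ∑ i, ‖V.starProjection (q i)‖ ^ 2 = s := by
    rw [← overlap_span_range V h.orthonormal_right, h.span_range_right, overlap_comm,
      overlap_eq_finrank_of_le hVW, hV]
  have hcos (i) (hi : i ∈ Finset.univ.filter fun i : Fin k ↦ k - s ≤ i.val) (j)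
      (hj : j ∉ Finset.univ.filter fun i : Fin k ↦ k - s ≤ i.val) :
      Real.cos (principalAngle L W i) ^ 2 < Real.cos (principalAngle L W j) ^ 2 := by
    have hij := hgap j i (by simpa only [Finset.mem_filter_univ, not_le] using hj)
      (by simpa only [Finset.mem_filter_univ] using hi)
    have hlt := Real.cos_lt_cos_of_nonneg_of_le_pi_div_two (principalAngle_mem_Icc L W j).1
      (principalAngle_mem_Icc L W i).2 hij
    exact pow_lt_pow_left₀ hlt (h.cos_principalAngle i ▸ h.nonneg i) two_ne_zero
  have hzero := eq_zero_of_sum_mul_le_sum hcos (w := fun i ↦ ‖V.starProjection (q i)‖ ^ 2)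
    (fun i ↦ by positivity)
    (fun i ↦ pow_le_one₀ (norm_nonneg _)
      ((V.norm_starProjection_apply_le (q i)).trans_eq (h.orthonormal_right.1 i)))
    (by rw [hsum, card_filter_le_val, Nat.sub_sub_self hsk])
    (by rwa [← overlap_eq_sum_of_le h hVW]) (j := j)
    (by simpa only [Finset.mem_filter_univ, not_le] using hj)
  simpa [Submodule.starProjection_apply_eq_zero_iff] using hzero

theorem exists_eq_sup_lastSpan (h : IsPrincipalVectors L W p q) (hsk : s ≤ k)
    (hgap : ∀ i j : Fin k, i.val < k - s → k - s ≤ j.val →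
      principalAngle L W i < principalAngle L W j)
    (hE : E ∈ schubert W s) (hdist : dist L E = maxDist L W s) :
    ∃ B ≤ L.spaceᗮ ⊓ (lastSpan s q)ᗮ, Module.finrank ℝ B = k - s ∧
      E.space = B ⊔ lastSpan s q := by
  obtain ⟨V, hV, hVs⟩ := exists_le_finrank_eq _ hE
  have hEV : V ⊔ Vᗮ ⊓ E.space = E.space :=
    Submodule.sup_orthogonal_inf_of_hasOrthogonalProjection (hV.trans inf_le_left)
  have hVB : V ⟂ Vᗮ ⊓ E.space := (Submodule.isOrtho_orthogonal_right V).mono_right inf_le_left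
  have hoverlap := (dist_eq_maxDist_iff hsk L hE).1 hdist
  rw [← hEV, overlap_sup_of_isOrtho _ hVB] at hoverlap
  have hnonneg := overlap_nonneg L.space (Vᗮ ⊓ E.space)
  obtain rfl := eq_lastSpan_of_overlap_le h hsk hgap (hV.trans inf_le_right) hVs (by linarith)
  rw [overlap_lastSpan h, add_eq_left, overlap_eq_zero_iff] at hoverlap
  refine ⟨_, le_inf hoverlap inf_le_left, ?_, by rw [sup_comm, hEV]⟩
  have hfinrank := finrank_sup_of_disjoint hVB.disjoint
  rw [hEV, E.finrank_space, hVs] at hfinrank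
  omega

theorem mem_schubert_of_space_eq_sup (h : IsPrincipalVectors L W p q) (hsk : s ≤ k)
    (hE : E.space = B ⊔ lastSpan s q) : E ∈ schubert W s := by
  have hle : lastSpan s q ≤ E.space ⊓ W.space := le_inf (hE ▸ le_sup_right) (lastSpan_le h s)
  exact (finrank_lastSpan hsk h.orthonormal_right).ge.trans (Submodule.finrank_mono hle)

theorem dist_eq_maxDist_of_space_eq_sup (h : IsPrincipalVectors L W p q) (hsk : s ≤ k)
    (hB : B ≤ L.spaceᗮ ⊓ (lastSpan s q)ᗮ) (hE : E.space = B ⊔ lastSpan s q) :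
    dist L E = maxDist L W s := by
  obtain ⟨hBL, hBq⟩ := le_inf_iff.1 hB
  rw [dist_eq_maxDist_iff hsk L (mem_schubert_of_space_eq_sup h hsk hE), hE,
    overlap_sup_of_isOrtho _ (Submodule.isOrtho_iff_le.2 hBq), overlap_eq_zero_iff.2 hBL,
    zero_add, overlap_lastSpan h]

theorem finrank_orthogonal_inf_orthogonal (S T : Submodule ℝ (Euc n)) :
    Module.finrank ℝ (Sᗮ ⊓ Tᗮ : Submodule ℝ (Euc n)) =
      n - Module.finrank ℝ (S ⊔ T : Submodule ℝ (Euc n)) := by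
  have hsum := (S ⊔ T).finrank_add_finrank_orthogonal
  rw [finrank_euclideanSpace_fin] at hsum
  rw [Submodule.inf_orthogonal]
  omega

theorem exists_dist_eq_maxDist (hkn : 2 * k ≤ n) (hsk : s ≤ k) (L W : Grass k n) :
    ∃ E ∈ schubert W s, dist L E = maxDist L W s := by
  obtain ⟨p, q, h⟩ := exists_isPrincipalVectors L W
  have hspan := finrank_lastSpan hsk h.orthonormal_right
  have hle := Submodule.finrank_add_le_finrank_add_finrank L.space (lastSpan s q)
  rw [L.finrank_space, hspan] at hle
  obtain ⟨B, hB, hBs⟩ := exists_le_finrank_eq (L.spaceᗮ ⊓ (lastSpan s q)ᗮ) (d := k - s)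
    (by rw [finrank_orthogonal_inf_orthogonal]; omega)
  have hBq : B ⟂ lastSpan s q := Submodule.isOrtho_iff_le.2 (hB.trans inf_le_right)
  let E : Grass k n := ⟨B ⊔ lastSpan s q, by
    rw [finrank_sup_of_disjoint hBq.disjoint, hBs, hspan, Nat.sub_add_cancel hsk]⟩
  exact ⟨E, mem_schubert_of_space_eq_sup h hsk rfl, dist_eq_maxDist_of_space_eq_sup h hsk hB rfl⟩

theorem isGreatest_maxDist (hkn : 2 * k ≤ n) (hsk : s ≤ k) (L W : Grass k n) :
    IsGreatest ((fun E ↦ dist L E) '' schubert W s) (maxDist L W s) := by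
  refine ⟨exists_dist_eq_maxDist hkn hsk L W, ?_⟩
  rintro _ ⟨E, hE, rfl⟩
  exact dist_le_maxDist hsk L hE

theorem mem_maximizers_iff (hkn : 2 * k ≤ n) (hsk : s ≤ k) :
    E ∈ maximizers L W s ↔ E ∈ schubert W s ∧ dist L E = maxDist L W s := by
  obtain ⟨E', hE', hdist⟩ := exists_dist_eq_maxDist hkn hsk L W
  refine and_congr_right fun hE ↦ ⟨fun hmax ↦ ?_, fun hmax F hF ↦ ?_⟩
  · exact (dist_le_maxDist hsk L hE).antisymm (hdist ▸ hmax hE')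
  · exact (dist_le_maxDist hsk L hF).trans_eq hmax.symm

theorem mem_maximizers_iff_exists_eq_sup (hkn : 2 * k ≤ n) (hsk : s ≤ k)
    (h : IsPrincipalVectors L W p q)
    (hgap : ∀ i j : Fin k, i.val < k - s → k - s ≤ j.val →
      principalAngle L W i < principalAngle L W j) :
    E ∈ maximizers L W s ↔ ∃ B ≤ L.spaceᗮ ⊓ (lastSpan s q)ᗮ, Module.finrank ℝ B = k - s ∧
      E.space = B ⊔ lastSpan s q := by
  rw [mem_maximizers_iff hkn hsk]
  constructor
  · rintro ⟨hE, hdist⟩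
    exact exists_eq_sup_lastSpan h hsk hgap hE hdist
  · rintro ⟨B, hB, -, hE⟩
    exact ⟨mem_schubert_of_space_eq_sup h hsk hE, dist_eq_maxDist_of_space_eq_sup h hsk hB hE⟩

theorem disjoint_lastSpan (h : IsPrincipalVectors L W p q)
    (hpos : ∀ i : Fin k, k - s ≤ i.val → 0 < principalAngle L W i) :
    Disjoint L.space (lastSpan s q) := by
  refine Submodule.disjoint_def.2 fun x hxL hxq ↦ ?_
  have hxW := lastSpan_le h s hxq
  have hcoord (i : Fin k) : ⟪q i, x⟫ = 0 := by
    by_cases hi : k - s ≤ i.val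
    · exact h.inner_right_eq_zero (hpos i hi) hxL hxW
    · exact inner_eq_zero_of_mem_span_image h.orthonormal_right hi hxq
  simpa [hcoord] using h.norm_sq_eq hxW

theorem finrank_orthogonal_inf_orthogonal_lastSpan (h : IsPrincipalVectors L W p q) (hsk : s ≤ k)
    (hpos : ∀ i : Fin k, k - s ≤ i.val → 0 < principalAngle L W i) :
    Module.finrank ℝ (L.spaceᗮ ⊓ (lastSpan s q)ᗮ : Submodule ℝ (Euc n)) = n - k - s := by
  rw [finrank_orthogonal_inf_orthogonal, finrank_sup_of_disjoint (disjoint_lastSpan h hpos),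
    L.finrank_space, finrank_lastSpan hsk h.orthonormal_right, Nat.sub_sub]

end Maximizers

end Grass

section Isometry

variable {V V' : Type*} [NormedAddCommGroup V] [InnerProductSpace ℝ V]
  [NormedAddCommGroup V'] [InnerProductSpace ℝ V']

theorem finrank_map_linearIsometry (φ : V →ₗᵢ[ℝ] V') (S : Submodule ℝ V) :
    Module.finrank ℝ (S.map φ.toLinearMap) = Module.finrank ℝ S :=
  (Submodule.equivMapOfInjective φ.toLinearMap φ.injective S).symm.finrank_eq

theorem starProjection_map_linearIsometry [FiniteDimensional ℝ V] [FiniteDimensional ℝ V']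
    (φ : V →ₗᵢ[ℝ] V') (S : Submodule ℝ V) :
    (S.map φ.toLinearMap).starProjection = φ.toContinuousLinearMap ∘L S.starProjection ∘L
      ContinuousLinearMap.adjoint φ.toContinuousLinearMap := by
  obtain ⟨u, hu, hS⟩ := exists_orthonormal_span_range_eq S rfl
  have hmap : S.map φ.toLinearMap = Submodule.span ℝ (Set.range (φ ∘ u)) := by
    refine (congrArg _ hS.symm).trans ?_
    rw [Submodule.map_span, Set.range_comp]
    rfl
  rw [Submodule.starProjection_inj.2 hmap,
    starProjection_span_range (hu.comp_linearIsometry φ), ← Submodule.starProjection_inj.2 hS,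
    starProjection_span_range hu]
  ext x
  simp [ContinuousLinearMap.adjoint_inner_right]

theorem adjoint_linearIsometry_apply [FiniteDimensional ℝ V] [FiniteDimensional ℝ V']
    (φ : V →ₗᵢ[ℝ] V') (x : V) :
    ContinuousLinearMap.adjoint φ.toContinuousLinearMap (φ x) = x :=
  ext_inner_right ℝ fun y ↦ by
    rw [ContinuousLinearMap.adjoint_inner_left]
    exact φ.inner_map_map x y

end Isometry

namespace Grass

theorem isEmbedding_starProjection (k n : ℕ) :
    Topology.IsEmbedding fun E : Grass k n ↦ E.space.starProjection :=
  ⟨⟨rfl⟩, fun _ _ h ↦ Subtype.ext (Submodule.starProjection_inj.1 h)⟩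

section Join

variable {d k m n : ℕ} {φ : Euc m →ₗᵢ[ℝ] Euc n} {V : Submodule ℝ (Euc n)}

theorem map_isOrtho (hφ : LinearMap.range φ.toLinearMap ⟂ V) (B : Grass d m) :
    B.space.map φ.toLinearMap ⟂ V :=
  hφ.mono_left LinearMap.map_le_range

/-- The map `B ↦ φ(B) ⊕ V` between Grassmannians, for an isometric embedding `φ` with image
orthogonal to `V`. -/
noncomputable def join (hφ : LinearMap.range φ.toLinearMap ⟂ V)
    (hd : d + Module.finrank ℝ V = k) (B : Grass d m) : Grass k n :=
  ⟨B.space.map φ.toLinearMap ⊔ V, by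
    rw [finrank_sup_of_disjoint (map_isOrtho hφ B).disjoint, finrank_map_linearIsometry,
      B.finrank_space, hd]⟩

theorem isEmbedding_join (hφ : LinearMap.range φ.toLinearMap ⟂ V)
    (hd : d + Module.finrank ℝ V = k) :
    Topology.IsEmbedding (join hφ hd : Grass d m → Grass k n) := by
  let Φ := φ.toContinuousLinearMap
  let conj (T : Euc m →L[ℝ] Euc m) : Euc n →L[ℝ] Euc n :=
    Φ ∘L T ∘L ContinuousLinearMap.adjoint Φ + V.starProjection
  let compress (S : Euc n →L[ℝ] Euc n) : Euc m →L[ℝ] Euc m :=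
    ContinuousLinearMap.adjoint Φ ∘L S ∘L Φ
  have hinv : Function.LeftInverse compress conj := fun T ↦ by
    ext1 x
    have hVφ : V.starProjection (φ x) = 0 :=
      V.starProjection_apply_eq_zero_iff.2 (Submodule.isOrtho_iff_le.1 hφ ⟨x, rfl⟩)
    simp [compress, conj, Φ, adjoint_linearIsometry_apply, hVφ]
  have hconj : Topology.IsEmbedding conj :=
    .of_leftInverse hinv (by fun_prop) (by fun_prop)
  have hjoin : (fun E : Grass k n ↦ E.space.starProjection) ∘ join hφ hd =
      conj ∘ fun B : Grass d m ↦ B.space.starProjection := by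
    funext B
    change (B.space.map φ.toLinearMap ⊔ V).starProjection = _
    rw [starProjection_sup_of_isOrtho (map_isOrtho hφ B), starProjection_map_linearIsometry]
    rfl
  rw [← (isEmbedding_starProjection k n).of_comp_iff, hjoin]
  exact hconj.comp (isEmbedding_starProjection d m)

theorem mem_range_join_iff (hφ : LinearMap.range φ.toLinearMap ⟂ V)
    (hd : d + Module.finrank ℝ V = k) {E : Grass k n} :
    E ∈ Set.range (join hφ hd : Grass d m → Grass k n) ↔
      ∃ B ≤ LinearMap.range φ.toLinearMap, Module.finrank ℝ B = d ∧ E.space = B ⊔ V := by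
  constructor
  · rintro ⟨B, rfl⟩
    exact ⟨B.space.map φ.toLinearMap, LinearMap.map_le_range,
      by rw [finrank_map_linearIsometry, B.finrank_space], rfl⟩
  · rintro ⟨B, hB, hBd, hE⟩
    have hmap : (B.comap φ.toLinearMap).map φ.toLinearMap = B := Submodule.map_comap_eq_of_le hB
    refine ⟨⟨B.comap φ.toLinearMap, ?_⟩, Subtype.ext ?_⟩
    · rw [← hBd, ← finrank_map_linearIsometry φ, hmap]
    · change (B.comap φ.toLinearMap).map φ.toLinearMap ⊔ V = E.space
      rw [hmap, hE]

end Join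

end Grass

section RegularityPolynomial

open Polynomial

/-- A universal polynomial in the coefficients of a monic polynomial `f`, which vanishes exactly
when `f` has a multiple root or one of the roots `0` and `1`; see
`regularityPoly_prod_X_sub_C_ne_zero_iff`. -/
noncomputable def regularityPoly {R : Type*} [CommRing R] (f : R[X]) : R :=
  f.resultant f.derivative f.natDegree f.natDegree * (f.eval 0 * f.eval 1)

theorem regularityPoly_map {R S : Type*} [CommRing R] [CommRing S] [Nontrivial S] (φ : R →+* S)
    {f : R[X]} (hf : f.Monic) : regularityPoly (f.map φ) = φ (regularityPoly f) := by
  rw [regularityPoly, derivative_map, hf.natDegree_map, resultant_map_map, eval_zero_map,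
    eval_one_map, regularityPoly, map_mul, map_mul]

theorem resultant_ne_zero_iff_isCoprime {K : Type*} [Field K] {f g : K[X]} (hf : f.Monic) {n : ℕ}
    (hg : g.natDegree ≤ n) : f.resultant g f.natDegree n ≠ 0 ↔ IsCoprime f g := by
  obtain ⟨d, rfl⟩ := Nat.exists_eq_add_of_le hg
  rw [resultant_add_right_deg _ _ _ _ _ le_rfl, hf.coeff_natDegree, one_pow, one_mul,
    ← isUnit_iff_ne_zero, isUnit_resultant_iff_isCoprime hf]

theorem regularityPoly_prod_X_sub_C_ne_zero_iff {K ι : Type*} [Field K] [Fintype ι] (a : ι → K) :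
    regularityPoly (∏ i, (X - C (a i))) ≠ 0 ↔
      Function.Injective a ∧ (∀ i, a i ≠ 0) ∧ ∀ i, a i ≠ 1 := by
  have hmonic : (∏ i, (X - C (a i))).Monic := monic_prod_X_sub_C a _
  rw [regularityPoly, mul_ne_zero_iff, mul_ne_zero_iff,
    resultant_ne_zero_iff_isCoprime hmonic ((natDegree_derivative_le _).trans (Nat.sub_le _ _)),
    ← separable_def, separable_prod_X_sub_C_iff]
  simp [eval_prod, Finset.prod_ne_zero_iff, sub_eq_zero, eq_comm (a := (1 : K))]

end RegularityPolynomial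

section Compression

variable {V ι : Type*} [NormedAddCommGroup V] [InnerProductSpace ℝ V]

/-- The Gram matrix `⟪w i, P w j⟫` of the orthogonal projection `P` onto `S`. If `w` is an
orthonormal basis of a subspace `T`, it represents the compression of `P` to `T`, whose
eigenvalues are the squared cosines of the principal angles. -/
noncomputable def compression (w : ι → V) (S : Submodule ℝ V) [S.HasOrthogonalProjection] :
    Matrix ι ι ℝ :=
  Matrix.of fun i j ↦ ⟪w i, S.starProjection (w j)⟫

theorem orthonormal_add_smul {u w : ι → V} (hu : Orthonormal ℝ u) (hw : Orthonormal ℝ w)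
    (huw : ∀ i j, ⟪u i, w j⟫ = 0) {a b : ι → ℝ} (hab : ∀ i, a i ^ 2 + b i ^ 2 = 1) :
    Orthonormal ℝ fun i ↦ a i • u i + b i • w i := by
  classical
  have hwu (i j) : ⟪w i, u j⟫ = 0 := by rw [real_inner_comm, huw]
  rw [orthonormal_iff_ite] at *
  intro i j
  simp only [inner_add_left, inner_add_right, real_inner_smul_left, real_inner_smul_right, hu, hw,
    huw, hwu]
  split_ifs with hij
  · subst hij
    linear_combination hab i
  · ring

theorem compression_span_range_add_smul [FiniteDimensional ℝ V] [Finite ι] [DecidableEq ι]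
    {u w : ι → V} (hu : Orthonormal ℝ u) (hw : Orthonormal ℝ w) (huw : ∀ i j, ⟪u i, w j⟫ = 0)
    {a b : ι → ℝ} (hab : ∀ i, a i ^ 2 + b i ^ 2 = 1) :
    compression u (Submodule.span ℝ (Set.range fun i ↦ a i • u i + b i • w i)) =
      Matrix.diagonal fun i ↦ a i ^ 2 := by
  cases nonempty_fintype ι
  have hwu (i j) : ⟪w i, u j⟫ = 0 := by rw [real_inner_comm, huw]
  ext i j
  simp only [compression, Matrix.of_apply,
    inner_starProjection_span_range (orthonormal_add_smul hu hw huw hab), inner_add_left,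
    real_inner_smul_left, hwu, orthonormal_iff_ite.1 hu]
  rcases eq_or_ne i j with rfl | hij
  · simp [sq]
  · simp [hij, hij.symm]

end Compression

namespace Grass

section Genericity

variable {k n : ℕ} {L W : Grass k n} {w : Fin k → Euc n}

theorem charpoly_compression (L : Grass k n) (hw : Orthonormal ℝ w)
    (hwW : Submodule.span ℝ (Set.range w) = W.space) :
    (compression w L.space).charpoly =
      ∏ i, (Polynomial.X - Polynomial.C (Real.cos (principalAngle L W i) ^ 2)) := by
  obtain ⟨p, q, h⟩ := exists_isPrincipalVectors L W
  have hmem (i) : w i ∈ W.space := hwW ▸ Submodule.subset_span ⟨i, rfl⟩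
  let O : Matrix (Fin k) (Fin k) ℝ := Matrix.of fun i a ↦ ⟪w i, q a⟫
  let D : Matrix (Fin k) (Fin k) ℝ := Matrix.diagonal fun i ↦ Real.cos (principalAngle L W i) ^ 2
  have hO : O.transpose * O = 1 := by
    ext a b
    have hqW : (Submodule.span ℝ (Set.range w)).starProjection (q b) = q b :=
      Submodule.starProjection_eq_self_iff.2 (hwW ▸ h.mem_right b)
    simp [O, Matrix.mul_apply, ← inner_starProjection_span_range hw, hqW, Matrix.one_apply,
      orthonormal_iff_ite.1 h.orthonormal_right]
  have hODO : compression w L.space = O * (D * O.transpose) := by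
    ext i j
    rw [Matrix.mul_apply]
    simp only [compression, Matrix.of_apply, ← h.span_range_left,
      inner_starProjection_span_range h.orthonormal_left, h.inner_left_eq _ (hmem _),
      Matrix.transpose_apply, Matrix.diagonal_mul, O, D, h.cos_principalAngle]
    refine Finset.sum_congr rfl fun a _ ↦ ?_
    rw [real_inner_comm (w i), real_inner_comm (w j)]
    ring
  rw [hODO, Matrix.charpoly_mul_comm, Matrix.mul_assoc, hO, mul_one, Matrix.charpoly_diagonal]

theorem monotone_principalAngle (E F : Grass k n) : Monotone (principalAngle E F) := by
  obtain ⟨p, q, h⟩ := exists_isPrincipalVectors E F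
  intro i j hij
  rw [principalAngle_eq h, principalAngle_eq h]
  exact Real.arccos_le_arccos (h.antitone hij)

theorem cos_sq_injOn : Set.InjOn (fun θ ↦ Real.cos θ ^ 2) (Set.Icc 0 (Real.pi / 2)) := by
  intro x hx y hy hxy
  have hcos {θ : ℝ} (hθ : θ ∈ Set.Icc 0 (Real.pi / 2)) : 0 ≤ Real.cos θ :=
    Real.cos_nonneg_of_mem_Icc ⟨by linarith [hθ.1, Real.pi_pos], hθ.2⟩
  have hpi := Real.pi_pos
  exact Real.injOn_cos ⟨hx.1, by linarith [hx.2]⟩ ⟨hy.1, by linarith [hy.2]⟩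
    ((sq_eq_sq₀ (hcos hx) (hcos hy)).1 hxy)

theorem mem_regularPlanes_iff (hw : Orthonormal ℝ w)
    (hwW : Submodule.span ℝ (Set.range w) = W.space) :
    L ∈ regularPlanes W ↔ regularityPoly (compression w L.space).charpoly ≠ 0 := by
  have hmem := principalAngle_mem_Icc L W
  have hpi := Real.pi_div_two_pos
  have hone (i) : Real.cos (principalAngle L W i) ^ 2 ≠ 1 ↔ 0 < principalAngle L W i := by
    have hinj := cos_sq_injOn.eq_iff (hmem i) (Set.left_mem_Icc.2 hpi.le)
    rw [Real.cos_zero, one_pow] at hinj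
    rw [ne_eq, hinj, (hmem i).1.lt_iff_ne']
  have hzero (i) : Real.cos (principalAngle L W i) ^ 2 ≠ 0 ↔
      principalAngle L W i < Real.pi / 2 := by
    have hinj := cos_sq_injOn.eq_iff (hmem i) (Set.right_mem_Icc.2 hpi.le)
    rw [Real.cos_pi_div_two, zero_pow two_ne_zero] at hinj
    rw [ne_eq, hinj, (hmem i).2.lt_iff_ne]
  have hinj : Function.Injective (fun i ↦ Real.cos (principalAngle L W i) ^ 2) ↔
      StrictMono (principalAngle L W) := by
    rw [(monotone_principalAngle L W).strictMono_iff_injective]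
    exact ⟨fun h ↦ .of_comp (f := fun θ ↦ Real.cos θ ^ 2) h,
      fun h i j hij ↦ h (cos_sq_injOn (hmem i) (hmem j) hij)⟩
  rw [charpoly_compression L hw hwW, regularityPoly_prod_X_sub_C_ne_zero_iff, hinj]
  simp only [hone, hzero, regularPlanes, Set.mem_ofPred_eq]
  tauto

theorem nonempty_regularPlanes (hkn : 2 * k ≤ n) (W : Grass k n) : (regularPlanes W).Nonempty := by
  obtain ⟨w, hw, hwW⟩ := exists_orthonormal_span_range_eq W.space W.finrank_space
  have hsum := W.space.finrank_add_finrank_orthogonal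
  rw [finrank_euclideanSpace_fin, W.finrank_space] at hsum
  obtain ⟨T, hT, hTk⟩ := exists_le_finrank_eq W.spaceᗮ (d := k) (by omega)
  obtain ⟨u, hu, huT⟩ := exists_orthonormal_span_range_eq T hTk
  have hwu (i j) : ⟪w i, u j⟫ = 0 :=
    hT (huT ▸ Submodule.subset_span ⟨j, rfl⟩) _ (hwW ▸ Submodule.subset_span ⟨i, rfl⟩)
  let d (i : Fin k) : ℝ := (i + 1) / (k + 1)
  have hd_pos (i) : 0 < d i := by positivity
  have hd_lt (i) : d i < 1 := by
    rw [div_lt_one (by positivity)]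
    exact_mod_cast Nat.succ_lt_succ i.2
  have hd_inj : Function.Injective d := fun i j hij ↦ by
    have hk : (k + 1 : ℝ) ≠ 0 := by positivity
    simpa [d, div_left_inj' hk, Fin.ext_iff] using hij
  have hab (i) : √(d i) ^ 2 + √(1 - d i) ^ 2 = 1 := by
    rw [Real.sq_sqrt (hd_pos i).le, Real.sq_sqrt (by linarith [hd_lt i])]
    ring
  let L : Grass k n := ⟨_, (finrank_span_eq_card
    (orthonormal_add_smul hw hu hwu hab).linearIndependent).trans (Fintype.card_fin k)⟩
  refine ⟨L, (mem_regularPlanes_iff hw hwW).2 ?_⟩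
  have hL : compression w L.space = Matrix.diagonal d := by
    have hdiag := compression_span_range_add_smul hw hu hwu hab
    simp only [Real.sq_sqrt (hd_pos _).le] at hdiag
    exact hdiag
  rw [hL, Matrix.charpoly_diagonal, regularityPoly_prod_X_sub_C_ne_zero_iff]
  exact ⟨hd_inj, fun i ↦ (hd_pos i).ne', fun i ↦ (hd_lt i).ne⟩

end Genericity

end Grass

theorem orthonormal_inv_norm_smul {V ι : Type*} [NormedAddCommGroup V] [InnerProductSpace ℝ V]
    {v : ι → V} (hne : ∀ i, v i ≠ 0) (hv : Pairwise fun i j ↦ ⟪v i, v j⟫ = 0) :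
    Orthonormal ℝ fun i ↦ ‖v i‖⁻¹ • v i :=
  ⟨fun i ↦ norm_smul_inv_norm (hne i), fun i j hij ↦ by
    simp only [real_inner_smul_left, real_inner_smul_right, hv hij, mul_zero]⟩

namespace Grass

variable {k n : ℕ}

theorem inner_starProjection_eq_sum_coord (L : Grass k n) (x y : Euc n) :
    ⟪x, L.space.starProjection y⟫ = ∑ a, ∑ b, x a * y b * L.coord (a, b) := by
  have hsum (x : Euc n) : ∑ a, x a • EuclideanSpace.single a (1 : ℝ) = x := by
    simpa using (EuclideanSpace.basisFun (Fin n) ℝ).sum_repr x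
  conv_lhs => rw [← hsum x, ← hsum y]
  simp only [map_sum, map_smul, sum_inner, inner_sum, real_inner_smul_left, real_inner_smul_right,
    coord, mul_assoc, mul_left_comm (y _)]
  rw [Finset.sum_comm]

theorem isInducing_coord (k n : ℕ) : Topology.IsInducing (coord : Grass k n → _) := by
  let ψ (c : Fin n × Fin n → ℝ) : Euc n →L[ℝ] Euc n :=
    ∑ a, ∑ b, c (a, b) •
      (EuclideanSpace.proj b : Euc n →L[ℝ] ℝ).smulRight (EuclideanSpace.single a (1 : ℝ))
  have hcoord : Continuous (coord : Grass k n → _) :=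
    continuous_pi fun ab ↦ by
      have hproj := (isEmbedding_starProjection k n).continuous
      exact continuous_const.inner (hproj.clm_apply continuous_const)
  have hψ : Continuous ψ := by fun_prop
  have hcomp : ψ ∘ coord = fun L : Grass k n ↦ L.space.starProjection := by
    ext1 L
    ext1 x
    refine ext_inner_left ℝ fun y ↦ ?_
    rw [inner_starProjection_eq_sum_coord]
    simp [ψ, inner_sum, inner_smul_right, EuclideanSpace.inner_single_right, mul_comm]
  exact .of_comp hcoord hψ (hcomp ▸ (isEmbedding_starProjection k n).isInducing)

theorem coord_eq_sum {L : Grass k n} {u : Fin k → Euc n} (hu : Orthonormal ℝ u)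
    (huL : Submodule.span ℝ (Set.range u) = L.space) (a b : Fin n) :
    L.coord (a, b) = ∑ i, u i a * u i b := by
  rw [coord, ← Submodule.starProjection_inj.2 huL, inner_starProjection_span_range hu]
  simp [EuclideanSpace.inner_single_right]

theorem IsPrincipalVectors.norm_sq_segment {E F : Grass k n} {p q : Fin k → Euc n}
    (h : IsPrincipalVectors E F p q) (t : ℝ) (i : Fin k) :
    ‖(1 - t) • p i + t • q i‖ ^ 2 = 1 - 2 * t * (1 - t) * (1 - ⟪p i, q i⟫) := by
  rw [norm_add_sq_real, norm_smul, norm_smul, h.orthonormal_left.1, h.orthonormal_right.1,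
    real_inner_smul_left, real_inner_smul_right, Real.norm_eq_abs, Real.norm_eq_abs, mul_one,
    mul_one, sq_abs, sq_abs]
  ring

theorem IsPrincipalVectors.orthonormal_segment {E F : Grass k n} {p q : Fin k → Euc n}
    (h : IsPrincipalVectors E F p q) (t : ℝ) :
    Orthonormal ℝ fun i ↦ ‖(1 - t) • p i + t • q i‖⁻¹ • ((1 - t) • p i + t • q i) := by
  refine orthonormal_inv_norm_smul (fun i ↦ ?_) fun i j hij ↦ ?_
  · refine norm_ne_zero_iff.1 (ne_zero_pow two_ne_zero ?_)
    rw [h.norm_sq_segment]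
    nlinarith [sq_nonneg (2 * t - 1), h.nonneg i, h.inner_le_one i]
  · simp only [inner_add_left, inner_add_right, real_inner_smul_left, real_inner_smul_right,
      h.orthonormal_left.2 hij, h.orthonormal_right.2 hij, h.inner_eq_zero hij,
      real_inner_comm (p j) (q i), h.inner_eq_zero hij.symm, mul_zero, add_zero]

theorem exists_analytic_curve (L₀ L₁ : Grass k n) :
    ∃ γ : ℝ → Grass k n, γ 0 = L₀ ∧ γ 1 = L₁ ∧
      ∀ ab, AnalyticOnNhd ℝ (fun t ↦ (γ t).coord ab) Set.univ := by
  obtain ⟨p, q, h⟩ := exists_isPrincipalVectors L₀ L₁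
  let v (t : ℝ) (i : Fin k) : Euc n := (1 - t) • p i + t • q i
  let γ (t : ℝ) : Grass k n := ⟨Submodule.span ℝ (Set.range fun i ↦ ‖v t i‖⁻¹ • v t i),
    (finrank_span_eq_card (h.orthonormal_segment t).linearIndependent).trans (Fintype.card_fin k)⟩
  have hcoord (t a b) : (γ t).coord (a, b) = ∑ i, (‖v t i‖ ^ 2)⁻¹ * (v t i a * v t i b) := by
    rw [coord_eq_sum (h.orthonormal_segment t) rfl]
    refine Finset.sum_congr rfl fun i _ ↦ ?_
    simp only [v, PiLp.smul_apply, smul_eq_mul]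
    ring
  have hv_zero : (fun i ↦ ‖v 0 i‖⁻¹ • v 0 i) = p := by
    ext1 i
    simp [v, h.orthonormal_left.1]
  have hv_one : (fun i ↦ ‖v 1 i‖⁻¹ • v 1 i) = q := by
    ext1 i
    simp [v, h.orthonormal_right.1]
  refine ⟨γ, Subtype.ext ?_, Subtype.ext ?_, fun ⟨a, b⟩ t _ ↦ ?_⟩
  · exact (congrArg (Submodule.span ℝ ∘ Set.range) hv_zero).trans h.span_range_left
  · exact (congrArg (Submodule.span ℝ ∘ Set.range) hv_one).trans h.span_range_right
  · simp only [hcoord, v, h.norm_sq_segment, PiLp.add_apply, PiLp.smul_apply]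
    refine Finset.analyticAt_fun_sum _ fun i _ ↦ .mul (.inv (by fun_prop) ?_) (by fun_prop)
    rw [← h.norm_sq_segment]
    exact pow_ne_zero 2 (norm_ne_zero_iff.2 fun h0 ↦ by
      simpa [h0] using (h.orthonormal_segment t).ne_zero i)

theorem dense_eval_coord_ne_zero (P : MvPolynomial (Fin n × Fin n) ℝ)
    (hP : ∃ L : Grass k n, MvPolynomial.eval L.coord P ≠ 0) :
    Dense {L : Grass k n | MvPolynomial.eval L.coord P ≠ 0} := by
  obtain ⟨L₁, hL₁⟩ := hP
  intro L₀
  obtain ⟨γ, hγ₀, hγ₁, hγ⟩ := exists_analytic_curve L₀ L₁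
  have hanalytic : AnalyticOnNhd ℝ (fun t ↦ MvPolynomial.eval (γ t).coord P) Set.univ :=
    AnalyticOnNhd.aeval_mvPolynomial hγ P
  have hne : ∀ᶠ t in nhdsWithin 0 {0}ᶜ, MvPolynomial.eval (γ t).coord P ≠ 0 := by
    by_contra hfreq
    refine hL₁ (hγ₁ ▸ hanalytic.eqOn_zero_of_preconnected_of_frequently_eq_zero
      isPreconnected_univ (Set.mem_univ 0) ?_ (Set.mem_univ 1))
    simpa only [Filter.Frequently] using hfreq
  have htendsto : Filter.Tendsto γ (nhdsWithin 0 {0}ᶜ) (nhds L₀) := by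
    refine Filter.Tendsto.mono_left ?_ nhdsWithin_le_nhds
    rw [(isInducing_coord k n).tendsto_nhds_iff, tendsto_pi_nhds, ← hγ₀]
    exact fun ab ↦ (hγ ab 0 (Set.mem_univ 0)).continuousAt.tendsto
  exact mem_closure_of_tendsto htendsto hne

/-- The entries of `compression w L.space`, as polynomials in the entries of the projection
matrix of `L`. -/
noncomputable def compressionPoly (w : Fin k → Euc n) :
    Matrix (Fin k) (Fin k) (MvPolynomial (Fin n × Fin n) ℝ) :=
  Matrix.of fun i j ↦ ∑ a, ∑ b, MvPolynomial.C (w i a * w j b) * MvPolynomial.X (a, b)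

theorem map_eval_coord_compressionPoly (w : Fin k → Euc n) (L : Grass k n) :
    (compressionPoly w).map (MvPolynomial.eval L.coord) = compression w L.space := by
  ext i j
  simp only [compressionPoly, compression, Matrix.map_apply, Matrix.of_apply,
    inner_starProjection_eq_sum_coord, map_sum, map_mul, MvPolynomial.eval_C, MvPolynomial.eval_X]

theorem isGeneric_regularPlanes (hkn : 2 * k ≤ n) (W : Grass k n) :
    IsGeneric (regularPlanes W) := by
  obtain ⟨w, hw, hwW⟩ := exists_orthonormal_span_range_eq W.space W.finrank_space
  let P := regularityPoly (compressionPoly w).charpoly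
  have heval (L : Grass k n) :
      MvPolynomial.eval L.coord P = regularityPoly (compression w L.space).charpoly := by
    rw [← regularityPoly_map _ (Matrix.charpoly_monic _), ← Matrix.charpoly_map,
      map_eval_coord_compressionPoly]
  have hregular (L : Grass k n) : MvPolynomial.eval L.coord P ≠ 0 ↔ L ∈ regularPlanes W := by
    rw [heval, mem_regularPlanes_iff hw hwW]
  obtain ⟨L, hL⟩ := nonempty_regularPlanes hkn W
  exact ⟨P, dense_eval_coord_ne_zero P ⟨L, (hregular L).2 hL⟩, fun L hL ↦ (hregular L).1 hL⟩

end Grass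

theorem mainTheorem2_general (k n s : ℕ) (hkn : 2 * k ≤ n) (hsk : s ≤ k) (W : Grass k n) :
    Grass.IsGeneric (Grass.regularPlanes W) ∧
    ∀ L : Grass k n,
      ((∃ i : Fin k, i.val < s ∧ 0 < Grass.principalAngle L W i) → L ∉ Grass.schubert W s) ∧
      IsGreatest ((fun E ↦ Grass.dist L E) '' Grass.schubert W s)
        (Real.sqrt ((∑ i : Fin k with k - s ≤ i.val, Grass.principalAngle L W i ^ 2)
          + ((k - s : ℕ) : ℝ) * (Real.pi / 2) ^ 2)) ∧
      ∀ p q : Fin k → Euc n, Grass.IsPrincipalVectors L W p q →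
        ∀ EW A : Submodule ℝ (Euc n),
          EW = Submodule.span ℝ (q '' {i : Fin k | k - s ≤ i.val}) →
          A = L.spaceᗮ ⊓ EWᗮ →
          Module.finrank ℝ EW = s ∧
          ((∀ i : Fin k, k - s ≤ i.val → 0 < Grass.principalAngle L W i) →
            Module.finrank ℝ A = n - k - s) ∧
          ((∀ i j : Fin k, i.val < k - s → k - s ≤ j.val →
              Grass.principalAngle L W i < Grass.principalAngle L W j) →
            (∀ E : Grass k n, E ∈ Grass.maximizers L W s ↔
              ∃ B : Submodule ℝ (Euc n), B ≤ A ∧ Module.finrank ℝ B = k - s ∧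
                E.space = B ⊔ EW) ∧
            ∀ (m : ℕ) (φ : Euc m →ₗᵢ[ℝ] Euc n), LinearMap.range φ.toLinearMap = A →
              ∃ f : Grass (k - s) m → Grass k n,
                (∀ B, (f B).space = B.space.map φ.toLinearMap ⊔ EW) ∧
                Topology.IsEmbedding f ∧
                Set.range f = Grass.maximizers L W s) := by
  refine ⟨Grass.isGeneric_regularPlanes hkn W, fun L ↦
    ⟨fun ⟨i, his, hi⟩ ↦ Grass.notMem_schubert his hi, Grass.isGreatest_maxDist hkn hsk L W, ?_⟩⟩
  rintro p q h _ _ rfl rfl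
  have hdim := Grass.finrank_lastSpan hsk h.orthonormal_right
  refine ⟨hdim, Grass.finrank_orthogonal_inf_orthogonal_lastSpan h hsk, fun hgap ↦ ?_⟩
  have hmax (E) := Grass.mem_maximizers_iff_exists_eq_sup (E := E) hkn hsk h hgap
  refine ⟨hmax, fun m φ hφ ↦ ?_⟩
  have hortho : LinearMap.range φ.toLinearMap ⟂ Grass.lastSpan s q := hφ.le.trans inf_le_right
  refine ⟨Grass.join hortho (by omega), fun B ↦ rfl, Grass.isEmbedding_join _ _, ?_⟩
  ext E
  rw [Grass.mem_range_join_iff, hφ]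
  exact (hmax E).symm

theorem mainTheorem2 (k n s : ℕ) (hkn : 2 * k ≤ n) (hs1 : 1 ≤ s) (hsk : s ≤ k)
    (W : Grass k n) :
    Grass.IsGeneric (Grass.regularPlanes W) ∧
    ∀ L ∈ Grass.regularPlanes W,
      L ∉ Grass.schubert W s ∧
      -- the maximum is attained, with the stated value
      IsGreatest ((fun E => Grass.dist L E) '' Grass.schubert W s)
        (Real.sqrt ((∑ i : Fin k with k - s ≤ i.val, Grass.principalAngle L W i ^ 2)
          + ((k - s : ℕ) : ℝ) * (Real.pi / 2) ^ 2)) ∧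
      -- the explicit description of the maximizers, through principal vectors
      ∀ p q : Fin k → Euc n, Grass.IsPrincipalVectors L W p q →
        ∀ EW A : Submodule ℝ (Euc n),
          EW = Submodule.span ℝ (q '' {i : Fin k | k - s ≤ i.val}) →
          A = L.spaceᗮ ⊓ EWᗮ →
          Module.finrank ℝ EW = s ∧
          Module.finrank ℝ A = n - k - s ∧
          (∀ E : Grass k n, E ∈ Grass.maximizers L W s ↔
            ∃ B : Submodule ℝ (Euc n), B ≤ A ∧ Module.finrank ℝ B = k - s ∧
              E.space = B ⊔ EW) ∧
          -- the set of maximizers is a copy of `G(k-s, n-k-s)`, embedded by `B ↦ B ⊕ EW`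
          ∀ φ : Euc (n - k - s) →ₗᵢ[ℝ] Euc n, LinearMap.range φ.toLinearMap = A →
            ∃ f : Grass (k - s) (n - k - s) → Grass k n,
              (∀ B, (f B).space = B.space.map φ.toLinearMap ⊔ EW) ∧
              Topology.IsEmbedding f ∧
              Set.range f = Grass.maximizers L W s := by
  obtain ⟨hgeneric, hmain⟩ := mainTheorem2_general k n s hkn hsk W
  refine ⟨hgeneric, fun L ⟨hpos, hmono, _⟩ ↦ ⟨(hmain L).1 ⟨⟨0, by omega⟩, hs1, hpos _⟩,
    (hmain L).2.1, fun p q h EW A hEW hA ↦ ?_⟩⟩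
  obtain ⟨hdimEW, hdimA, hmax⟩ := (hmain L).2.2 p q h EW A hEW hA
  have hgap := hmax fun i j hi hj ↦ hmono (hi.trans_le hj)
  exact ⟨hdimEW, hdimA fun i _ ↦ hpos i, hgap.1, hgap.2 _⟩
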